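/- All graphs are finite and simple, and an orientation of a graph chooses exactly one of the two possible directions for each edge. A graph is planar if it can be embedded in the sphere without crossings; combinatorially: if its darts can be arranged in a cyclic order around every vertex so that every connected component, with the faces traced by this rotation system, satisfies Euler's formula of the sphere. An acyclic $k$-colouring of a digraph $D$ is a map $c : V(D) \to \{1,\dots,k\}$ such that no colour class contains the vertex set of a directed cycle of $D$; the dichromatic number $\vec\chi(D)$ is the least $k \ge 1$ for which such a colouring exists, and $\vec\chi(G)$, for an undirected graph $G$, is the maximum of $\vec\chi(D)$ over all orientations $D$ of $G$. Neumann-Lara's conjecture states that $\vec\chi(G) \le 2$ for every planar graph $G$. **Corollary 2.3.** Assume Neumann-Lara's conjecture. Let $G$ be a planar graph and let $D$ be an orientation of $G$. Then: 1. $D$ has an acyclic $2$-colouring under which no triangle of $G$ is monochromatic. 2. For every edge $a_1a_2$ of $G$ and every map $p : \{a_1,a_2\} \to \{1,2\}$ there is an acyclic $2$-colouring $c$ of $D$ under which no triangle of $G$ is monochromatic, with $c(a_i) = p(a_i)$ for $i = 1,2$. 3. For every triangle $a_1a_2a_3$ of $G$ and every non-constant map $p : \{a_1,a_2,a_3\}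 \to \{1,2\}$ there is an acyclic $2$-colouring $c$ of $D$ under which no triangle of $G$ is monochromatic, with $c(a_i) = p(a_i)$ for $i = 1,2,3$. -/

import Mathlib

universe u

/-! ### Acyclic colourings of digraphs -/

namespace Digraph

variable {V : Type u}

/-- `D` is an orientation of the simple graph `G`: every edge of `G` carries exactly one of its two
possible arcs, and there are no other arcs (so no loops and no anti-parallel arcs). -/
structure IsOrientationOf (D : Digraph V) (G : SimpleGraph V) : Prop where
  adj_iff : ∀ x y, G.Adj x y ↔ D.Adj x y ∨ D.Adj y x
  asymm : ∀ x y, D.Adj x y → ¬ D.Adj y x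

/-- The induced subdigraph `D[X]` is acyclic: no vertex can be reached from itself by a directed
walk of positive length all of whose vertices lie in `X`. -/
def IsAcyclicOn (D : Digraph V) (X : Set V) : Prop :=
  ∀ x, ¬ Relation.TransGen (fun y z => y ∈ X ∧ z ∈ X ∧ D.Adj y z) x x

/-- An acyclic colouring with `k` colours: every colour class is acyclic. -/
def IsAcyclicColouring (D : Digraph V) {k : ℕ} (c : V → Fin k) : Prop :=
  ∀ i, D.IsAcyclicOn (c ⁻¹' {i})

/-- The dichromatic number of a digraph: the least `k ≥ 1` for which an acyclic colouring with
`k` colours exists (`⊤` if there is none). -/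
noncomputable def dichromaticNumber (D : Digraph V) : ℕ∞ :=
  ⨅ k ∈ {k : ℕ | 1 ≤ k ∧ ∃ c : V → Fin k, D.IsAcyclicColouring c}, (k : ℕ∞)

end Digraph

namespace SimpleGraph

variable {V : Type u}

/-- The dichromatic number of an undirected graph: the maximum dichromatic number of an
orientation. -/
noncomputable def dichromaticNumber (G : SimpleGraph V) : ℕ∞ :=
  ⨆ D ∈ {D : Digraph V | D.IsOrientationOf G}, D.dichromaticNumber

/-- No triangle of `G` is monochromatic under `c`. -/
def NoMonochromaticTriangle (G : SimpleGraph V) {k : ℕ} (c : V → Fin k) : Prop :=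
  ∀ x y z, G.Adj x y → G.Adj y z → G.Adj x z → ¬ (c x = c y ∧ c y = c z)

/-! ### Planar graphs

A crossing-free drawing on the sphere is described, up to homeomorphism of the pieces, by its
rotation system: the cyclic order in which the edges leave each vertex.  Conversely a rotation
system describes a cellular embedding of each connected component in a closed oriented surface,
and this surface is a sphere exactly when Euler's formula holds for the component. -/

/-- A rotation system on `G`: a permutation of the darts (oriented edges) of `G` which permutes the
darts leaving any given vertex cyclically. -/
structure RotationSystem (G : SimpleGraph V) where
  /-- the next dart, in the cyclic order around the tail of the given dart -/
  next : Equiv.Perm G.Dart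
  sameCycle_iff : ∀ d e : G.Dart, next.SameCycle d e ↔ d.fst = e.fst

namespace RotationSystem

variable {G : SimpleGraph V}

/-- Face tracing: after walking along a dart `d`, continue with the dart that follows the reversal
of `d` in the rotation around the head of `d`. -/
def facePerm (R : RotationSystem G) : Equiv.Perm G.Dart :=
  (Function.Involutive.toPerm Dart.symm Dart.symm_involutive).trans R.next

/-- The number of faces of the embedded components: one face for every orbit of face tracing, and
one face (without any dart on its boundary) for every component that is an isolated vertex. -/
noncomputable def numFaces (R : RotationSystem G) : ℕ :=
  Nat.card (Quotient (Equiv.Perm.SameCycle.setoid R.facePerm)) + {v | G.IsIsolated v}.ncard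

/-- Every connected component is embedded in a sphere: Euler's formula `V - E + F = 2 * C`, where
`C` is the number of connected components.  Each component contributes `2 - 2 g` to `V - E + F`,
where `g ≥ 0` is the genus of its surface, so this says that all genera are zero. -/
def IsSpherical (R : RotationSystem G) : Prop :=
  Nat.card V + R.numFaces = G.edgeSet.ncard + 2 * Nat.card G.ConnectedComponent

end RotationSystem

/-- A (finite) graph is planar if it has a combinatorial embedding in the sphere. -/
def IsPlanar (G : SimpleGraph V) : Prop :=
  ∃ R : RotationSystem G, R.IsSpherical

end SimpleGraph

/-- Neumann-Lara's conjecture: planar graphs have dichromatic number at most `2`. -/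
def NeumannLaraConjecture : Prop :=
  ∀ (V : Type) [Finite V] (G : SimpleGraph V), G.IsPlanar → G.dichromaticNumber ≤ 2

/-!
The conjecture only provides acyclic `2`-colourings of orientations of planar graphs.  The stronger
conclusions come from applying it to larger planar graphs.

* An octahedron whose outer triangle is a given facial triangle can be directed, whatever the
  directions on the outer triangle are, such that the outer triangle is not monochromatic in any
  acyclic `2`-colouring (`blocker`, `not_mono_of_blocker`).  With octahedra in all facial triangles,
  no facial triangle is monochromatic.
* Let `x y` be a side of a facial triangle.  Gluing three copies of the graph into an octahedron
  puts copies of this side on the three edges of one triangle; two vertices of this triangle have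
  the same colour, hence in one of the copies `x` and `y` do
  (`PlaneDigraph.exists_isAcyclicColouring_eq`).  Together with the octahedra in the other faces:
  there is an acyclic colouring in which `x` and `y` have the same colour and no facial triangle is
  monochromatic (`PlaneDigraph.exists_isAcyclicColouring_faces`).
* If every triangle is facial, this treats all triangles.  Otherwise there is a separating
  triangle, and induction applies to its two closed sides.  A colouring of one side is not constant
  on the separating triangle, and, up to exchanging the two colours, every non-constant colouring of
  a triangle is determined by the pair of its vertices with equal colours; so some colouring of
  the other side agrees with it on the separating triangle.  Their union is acyclic because a
  directed cycle can be shortcut along the arcs of the triangle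
  (`NeumannLaraConjecture.exists_isGoodColouring_eq`, `Digraph.IsAcyclicOn.of_cover`).

This gives the claim on triangles.  An edge becomes the side of a triangle after a new vertex is
joined to its two ends, and the new vertex can be coloured such that the triangle is not
monochromatic.

The topology is done with permutations of darts.  The genus inequality
`Equiv.Perm.numCycles_add_le` bounds the numbers of cycles of `σ`, `τ` and `σ * τ` by the number of
points plus twice the number of orbits; it is proved by removing points from the cycles of `τ` one
at a time.  It gives one half of Euler's formula for every rotation system, so that planarity of
a constructed graph follows from a lower bound on its number of faces, and it gives the Jordan
curve theorem for triangles: cutting the sphere open along a triangle would violate the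
inequality unless it produced a new component
(`SimpleGraph.RotationSystem.IsSpherical.isFace_or_separates`).
-/

/-! ### Cycles of permutations -/

namespace Equiv.Perm

variable {α : Type*} {β : Type*}

lemma SameCycle.map_eq {p : Perm α} (h : α → β) (hh : ∀ x, h (p x) = h x) {x y : α}
    (H : p.SameCycle x y) : h x = h y := by
  obtain ⟨i, rfl⟩ := H
  induction i using Int.induction_on with
  | zero => rfl
  | succ n ih => rw [add_comm, zpow_one_add, mul_apply, hh, ih]
  | pred n ih =>
    rw [ih, ← hh ((p ^ (-(n : ℤ) - 1)) x), ← mul_apply, ← zpow_one_add]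
    congr 3
    ring

lemma SameCycle.rel {p : Perm α} {r : α → α → Prop} (hr : Equivalence r)
    (h : ∀ x, r x (p x)) {x y : α} (H : p.SameCycle x y) : r x y :=
  Quotient.exact (s := ⟨r, hr⟩)
    (H.map_eq (Quotient.mk ⟨r, hr⟩) fun x => Quotient.sound (hr.symm (h x)))

/-- Going once around a cycle of `p`, all its elements are linked even if the step from `q` to
`p q` is not used. -/
lemma SameCycle.rel_of_avoid [Finite α] {p : Perm α} {r : α → α → Prop} (hr : Equivalence r)
    {q z : α} (h : ∀ x, p.SameCycle q x → x ≠ q → r x (p x)) (H : p.SameCycle (p q) z) :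
    r (p q) z := by
  obtain ⟨n, rfl⟩ := H.exists_nat_pow_eq
  clear H
  induction n with
  | zero => exact hr.refl _
  | succ n ih =>
    rw [pow_succ', mul_apply]
    by_cases hq : (p ^ n) (p q) = q
    · rw [hq]
      exact hr.refl _
    · exact hr.trans ih (h _ (by simp [SameCycle.rfl]) hq)

/-- The number of cycles of a permutation, fixed points included. -/
noncomputable def numCycles (p : Perm α) : ℕ := Nat.card (Quotient (SameCycle.setoid p))

end Equiv.Perm

/-- If `s` is at most the join of `r` with the identification of `x` and `y`, then `r` has at most
one class more than `s`. -/
lemma Setoid.card_quotient_le_succ {α : Type*} [Finite α] (r s : Setoid α) (x y : α)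
    (h : ∀ t : Setoid α, r ≤ t → t x y → s ≤ t) :
    Nat.card (Quotient r) ≤ Nat.card (Quotient s) + 1 := by
  classical
  -- `g` collapses the class of `y` to the class of `x`
  let g : α → Quotient r := fun z => if r z y then Quotient.mk r x else Quotient.mk r z
  have hg : ∀ u v, s u v → g u = g v := by
    refine fun u v huv => h (Setoid.ker g) (fun a b hab => ?_) ?_ huv
    · have h1 : r a y ↔ r b y := ⟨r.trans' (r.symm' hab), r.trans' hab⟩
      have h2 : Quotient.mk r a = Quotient.mk r b := Quotient.sound hab
      simp only [Setoid.ker_def, g, h1, h2]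
    · simp only [Setoid.ker_def, g, r.refl' y, if_true]
      split_ifs <;> rfl
  let f : Quotient r → Option (Quotient s) := fun q =>
    if q = Quotient.mk r y then none else some (Quotient.mk s q.out)
  have hf : Function.Injective f := by
    intro q q' hqq
    by_cases hq : q = Quotient.mk r y <;> by_cases hq' : q' = Quotient.mk r y
    · rw [hq, hq']
    · simp [f, hq, hq'] at hqq
    · simp [f, hq, hq'] at hqq
    · simp only [f, hq, hq', if_false, Option.some.injEq] at hqq
      have h1 : ∀ q : Quotient r, q ≠ Quotient.mk r y → g q.out = q := fun q hq => by
        have h2 : ¬ r q.out y := fun hr =>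
          hq (by rw [← Quotient.out_eq q]; exact Quotient.sound hr)
        simp [g, h2]
      rw [← h1 q hq, ← h1 q' hq']
      exact hg _ _ (Quotient.exact hqq)
  calc Nat.card (Quotient r) ≤ Nat.card (Option (Quotient s)) :=
        Nat.card_le_card_of_injective f hf
    _ = _ := Finite.card_option

/-- If `s` strictly coarsens `r`, it has fewer classes. -/
lemma Setoid.card_quotient_succ_le {α : Type*} [Finite α] (r s : Setoid α) {x y : α}
    (h : ∀ u v, r u v → s u v) (hs : s x y) (hr : ¬ r x y) :
    Nat.card (Quotient s) + 1 ≤ Nat.card (Quotient r) := by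
  let f : Quotient r → Quotient s := Quotient.lift (Quotient.mk s) fun u v huv =>
    Quotient.sound (h u v huv)
  have hf : Function.Surjective f := fun q => by
    induction q using Quotient.inductionOn with
    | h a => exact ⟨Quotient.mk r a, rfl⟩
  rw [Nat.add_one_le_iff]
  refine lt_of_le_of_ne (Nat.card_le_card_of_surjective f hf) fun hcard => hr ?_
  have := (hf.bijective_of_nat_card_le hcard.ge).1
  exact Quotient.exact (this (Quotient.sound hs : f (Quotient.mk r x) = f (Quotient.mk r y)))

namespace Equiv.Perm

variable {α : Type*} [DecidableEq α]

/-- Multiplication by a transposition merges at most two cycles. -/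
lemma numCycles_le_mul_swap [Finite α] (p : Perm α) (x y : α) :
    p.numCycles ≤ (p * swap x y).numCycles + 1 := by
  refine Setoid.card_quotient_le_succ _ _ x y fun t ht hxy u v huv => ?_
  refine SameCycle.rel t.iseqv (fun z => ?_) huv
  have h1 : ∀ z, t z (p z) := fun z => ht (sameCycle_apply_right.2 (SameCycle.refl p z))
  rw [mul_apply]
  by_cases hzx : z = x
  · rw [hzx, swap_apply_left]
    exact t.trans' hxy (h1 y)
  · by_cases hzy : z = y
    · rw [hzy, swap_apply_right]
      exact t.trans' (t.symm' hxy) (h1 x)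
    · rw [swap_apply_of_ne_of_ne hzx hzy]
      exact h1 z

/-- Multiplication by a transposition of two elements of a cycle splits this cycle. -/
lemma SameCycle.not_mul_swap [Finite α] {p : Perm α} {x y : α} (hxy : x ≠ y)
    (H : p.SameCycle x y) : ¬ (p * swap x y).SameCycle x y := by
  have H' : ∃ k, 0 < k ∧ (p ^ k) y = x := by
    obtain ⟨k, hk⟩ := H.symm.exists_nat_pow_eq
    refine ⟨k, Nat.pos_of_ne_zero ?_, hk⟩
    rintro rfl
    exact hxy hk.symm
  classical
  obtain ⟨hk0, hk⟩ := Nat.find_spec H'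
  have hmin : ∀ j, 0 < j → j < Nat.find H' → (p ^ j) y ≠ x := fun j h0 hj h =>
    Nat.find_min H' hj ⟨h0, h⟩
  set k := Nat.find H'
  have hy : ∀ j, 0 < j → j ≤ k → (p ^ j) y ≠ y := by
    intro j h0 hj h
    rcases hj.eq_or_lt with rfl | hj
    · exact hxy (hk.symm.trans h)
    · refine hmin (k - j) (by omega) (by omega) ?_
      rw [← hk]
      conv_rhs => rw [show k = (k - j) + j by omega, pow_add, mul_apply, h]
  intro hs
  have key : ∀ n : ℕ, ∃ j, 0 < j ∧ j ≤ k ∧ ((p * swap x y) ^ n) x = (p ^ j) y := by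
    intro n
    induction n with
    | zero => exact ⟨k, hk0, le_rfl, hk.symm⟩
    | succ n ih =>
      obtain ⟨j, h0, hj, h⟩ := ih
      rw [pow_succ', mul_apply, h, mul_apply]
      rcases hj.eq_or_lt with rfl | hj
      · exact ⟨1, one_pos, hk0, by rw [hk]; simp⟩
      · exact ⟨j + 1, by omega, by omega, by
          rw [swap_apply_of_ne_of_ne (hmin j h0 hj) (hy j h0 hj.le), pow_succ', mul_apply]⟩
  obtain ⟨n, hn⟩ := hs.exists_nat_pow_eq
  obtain ⟨j, h0, hj, h⟩ := key n
  exact hy j h0 hj (h.symm.trans hn)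

lemma SameCycle.numCycles_mul_swap [Finite α] {p : Perm α} {x y : α} (hxy : x ≠ y)
    (H : p.SameCycle x y) : p.numCycles + 1 ≤ (p * swap x y).numCycles := by
  refine Setoid.card_quotient_succ_le _ _ ?_ H (H.not_mul_swap hxy)
  intro u v huv
  refine SameCycle.rel (SameCycle.equivalence p) (fun z => ?_) huv
  rw [mul_apply, sameCycle_apply_right]
  by_cases hzx : z = x
  · subst hzx; simpa using H
  · by_cases hzy : z = y
    · subst hzy; simpa using H.symm
    · rw [swap_apply_of_ne_of_ne hzx hzy]

/-- Multiplication by a transposition of two elements of different cycles puts them into the same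
cycle. -/
lemma sameCycle_mul_swap [Finite α] {p : Perm α} {x y : α}
    (H : ¬ p.SameCycle x y) : (p * swap x y).SameCycle x y := by
  have hr := SameCycle.equivalence (p * swap x y)
  have h1 : (p * swap x y).SameCycle (p y) y := by
    refine SameCycle.rel_of_avoid (p := p) hr (fun z hz hzy => ?_) (by simp [SameCycle.rfl])
    have hzx : z ≠ x := fun h => H (h ▸ hz.symm)
    have := (SameCycle.refl (p * swap x y) z).apply_right
    rwa [mul_apply, swap_apply_of_ne_of_ne hzx hzy] at this
  have h2 : (p * swap x y).SameCycle x (p y) := by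
    have := (SameCycle.refl (p * swap x y) x).apply_right
    rwa [mul_apply, swap_apply_left] at this
  exact h2.trans h1

/-! ### The genus inequality -/

/-- The relation whose classes are the orbits of the group generated by two permutations. -/
def orbitSetoid {α : Type*} (σ τ : Perm α) : Setoid α :=
  Relation.EqvGen.setoid fun x y => y = σ x ∨ y = τ x

/-- The number of orbits of the group generated by two permutations. -/
noncomputable def numOrbits {α : Type*} (σ τ : Perm α) : ℕ := Nat.card (Quotient (orbitSetoid σ τ))

lemma orbitSetoid_left {α : Type*} (σ τ : Perm α) (x : α) : orbitSetoid σ τ x (σ x) :=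
  Relation.EqvGen.rel _ _ (Or.inl rfl)

lemma orbitSetoid_right {α : Type*} (σ τ : Perm α) (x : α) : orbitSetoid σ τ x (τ x) :=
  Relation.EqvGen.rel _ _ (Or.inr rfl)

lemma orbitSetoid_le {α : Type*} {σ τ : Perm α} {t : Setoid α} (h₁ : ∀ x, t x (σ x))
    (h₂ : ∀ x, t x (τ x)) : orbitSetoid σ τ ≤ t := by
  refine fun x y hxy => Setoid.eqvGen_le (s := t) ?_ hxy
  rintro x y (rfl | rfl)
  exacts [h₁ x, h₂ x]

/-- The effect on cycles and orbits of removing the element `d` from its cycle in `τ`, by turning it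
into a fixed point: two cycles of `σ * τ` are merged only if no orbit is split. -/
lemma numCycles_mul_add_numOrbits_le [Finite α] (σ τ : Perm α) {d : α} (hd : τ d ≠ d) :
    (σ * τ).numCycles + 2 * numOrbits σ (swap d (τ d) * τ) ≤
      (σ * (swap d (τ d) * τ)).numCycles + 2 * numOrbits σ τ + 1 := by
  set τ' := swap d (τ d) * τ with hτ'
  set e := τ⁻¹ d with he
  have hτe : τ e = d := by simp [he]
  have hed : e ≠ d := fun h => hd (by rwa [h] at hτe)
  have hmul : σ * τ' = σ * τ * swap e d := by
    rw [hτ', swap_mul_eq_mul_swap, ← mul_assoc]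
    simp [he]
  have h'd : τ' d = d := by simp [hτ']
  have h'e : τ' e = τ d := by simp [hτ', hτe]
  have h'z : ∀ z, z ≠ d → z ≠ e → τ' z = τ z := fun z h1 h2 => by
    rw [hτ', mul_apply, swap_apply_of_ne_of_ne]
    · exact fun h => h2 (τ.injective (h.trans hτe.symm))
    · exact fun h => h1 (τ.injective h)
  have hle : ∀ t : Setoid α, orbitSetoid σ τ' ≤ t → t (τ d) d → orbitSetoid σ τ ≤ t := by
    intro t ht hdt
    refine orbitSetoid_le (fun x => ht (orbitSetoid_left σ τ' x)) fun x => ?_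
    by_cases h1 : x = d
    · rw [h1]; exact t.symm' hdt
    by_cases h2 : x = e
    · rw [h2, hτe]
      refine t.trans' ?_ hdt
      rw [← h'e]
      exact ht (orbitSetoid_right σ τ' e)
    · rw [← h'z x h1 h2]; exact ht (orbitSetoid_right σ τ' x)
  by_cases hs : (σ * τ).SameCycle e d
  · have h1 := hs.numCycles_mul_swap hed
    rw [← hmul] at h1
    have h2 : numOrbits σ τ' ≤ numOrbits σ τ + 1 := Setoid.card_quotient_le_succ _ _ _ _ hle
    omega
  · have h1 := numCycles_le_mul_swap (σ * τ) e d
    have h2 := sameCycle_mul_swap hs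
    rw [← hmul] at h1 h2
    have h3 : ∀ x, orbitSetoid σ τ' x ((σ * τ') x) := fun x =>
      (orbitSetoid σ τ').trans' (orbitSetoid_right σ τ' x) (orbitSetoid_left σ τ' _)
    have h4 : orbitSetoid σ τ' e d := SameCycle.rel (orbitSetoid σ τ').iseqv h3 h2
    have h5 := orbitSetoid_right σ τ' e
    rw [h'e] at h5
    have h6 := hle _ le_rfl ((orbitSetoid σ τ').trans' ((orbitSetoid σ τ').symm' h5) h4)
    have h7 : numOrbits σ τ' ≤ numOrbits σ τ := by
      refine Nat.card_le_card_of_surjective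
        (Quotient.lift (Quotient.mk (orbitSetoid σ τ')) fun u v huv => Quotient.sound (h6 huv)) ?_
      intro q
      induction q using Quotient.inductionOn with
      | h a => exact ⟨Quotient.mk _ a, rfl⟩
    omega

lemma numCycles_one {α : Type*} : (1 : Perm α).numCycles = Nat.card α := by
  refine (Nat.card_congr (Equiv.ofBijective (Quotient.mk (SameCycle.setoid (1 : Perm α))) ?_)).symm
  exact ⟨fun x y h => sameCycle_one.1 (Quotient.exact h), Quotient.mk_surjective⟩

/-- The genus inequality: the Euler characteristic of a closed oriented surface is at most twice the
number of its components.  Here the surface is composed of the cycles of `σ`, `τ` and `σ * τ` as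
vertices, hyperedges and faces, and has `numOrbits σ τ` components. -/
theorem numCycles_add_le [Finite α] (σ τ : Perm α) :
    σ.numCycles + τ.numCycles + (σ * τ).numCycles ≤ Nat.card α + 2 * numOrbits σ τ := by
  classical
  have := Fintype.ofFinite α
  induction hn : τ.support.card using Nat.strong_induction_on generalizing τ with
  | _ n ih =>
  by_cases hτ : τ = 1
  · subst hτ
    have h : σ.numCycles ≤ numOrbits σ 1 := by
      refine Nat.card_le_card_of_surjective
        (Quotient.lift (Quotient.mk (SameCycle.setoid σ)) fun u v huv => Quotient.sound ?_) ?_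
      · refine orbitSetoid_le (t := SameCycle.setoid σ) (fun x => ?_) (fun x => ?_) huv
        · exact sameCycle_apply_right.2 (SameCycle.refl σ x)
        · exact SameCycle.refl σ x
      · intro q
        induction q using Quotient.inductionOn with
        | h a => exact ⟨Quotient.mk _ a, rfl⟩
    rw [numCycles_one, mul_one]
    omega
  · obtain ⟨d, hd⟩ : ∃ d, τ d ≠ d := by
      by_contra! h
      exact hτ (Equiv.ext h)
    have hlt : (swap d (τ d) * τ).support.card < n := by
      rw [← hn]
      refine Finset.card_lt_card ⟨fun x hx => ?_, fun h => ?_⟩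
      · rw [mem_support, mul_apply] at hx
        rw [mem_support]
        intro h
        rw [h] at hx
        by_cases h1 : x = d
        · exact hd (h1 ▸ h)
        by_cases h2 : x = τ d
        · exact hd (τ.injective (h2 ▸ h))
        exact hx (swap_apply_of_ne_of_ne h1 h2)
      · have := h (mem_support.2 hd)
        simp at this
    have h1 := ih _ hlt (swap d (τ d) * τ) rfl
    have h2 := numCycles_mul_add_numOrbits_le σ τ hd
    have h3 : τ.numCycles + 1 ≤ (swap d (τ d) * τ).numCycles := by
      rw [swap_mul_eq_mul_swap]
      refine SameCycle.numCycles_mul_swap ?_ ?_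
      · simpa using fun h : τ⁻¹ d = d => hd (inv_eq_iff_eq.1 h).symm
      · exact ⟨1, by simp⟩
    omega

end Equiv.Perm

/-! ### First return permutations -/

namespace Equiv.Perm

variable {α β : Type*}

/-- The first return permutation of `p` on a part of `α`, given by an injection `i : β → α`. -/
lemma exists_firstReturn [Finite α] (p : Perm α) (i : β → α) (hi : Function.Injective i) :
    ∃ f : Perm β, ∀ b, ∃ n, 0 < n ∧ i (f b) = (p ^ n) (i b) ∧
      ∀ m, 0 < m → m < n → (p ^ m) (i b) ∉ Set.range i := by
  classical
  have hβ : Finite β := Finite.of_injective i hi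
  have hex : ∀ b, ∃ n, 0 < n ∧ (p ^ n) (i b) ∈ Set.range i := fun b =>
    ⟨orderOf p, orderOf_pos p, b, by simp [pow_orderOf_eq_one]⟩
  have h1 : ∀ b, ∃ b' n, 0 < n ∧ i b' = (p ^ n) (i b) ∧
      ∀ m, 0 < m → m < n → (p ^ m) (i b) ∉ Set.range i := by
    intro b
    obtain ⟨h0, b', hb'⟩ := Nat.find_spec (hex b)
    exact ⟨b', Nat.find (hex b), h0, hb', fun m hm hlt h => Nat.find_min (hex b) hlt ⟨hm, h⟩⟩
  choose f n hn hf hmin using h1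
  have hinj : Function.Injective f := by
    have key : ∀ b c, f b = f c → n b ≤ n c → b = c := by
      intro b c hbc hle
      have h := (hf b).symm.trans ((congrArg i hbc).trans (hf c))
      have h2 : i b = (p ^ (n c - n b)) (i c) := by
        apply (p ^ n b).injective
        rw [h, ← mul_apply, ← pow_add, Nat.add_sub_cancel' hle]
      rcases hle.eq_or_lt with heq | hlt
      · exact hi (by simpa [heq] using h2)
      · have := hn b
        exact absurd ⟨b, h2⟩ (hmin c (n c - n b) (by omega) (by omega))
    intro b c hbc
    rcases le_total (n b) (n c) with h | h
    · exact key b c hbc h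
    · exact (key c b hbc.symm h).symm
  exact ⟨Equiv.ofBijective f (Finite.injective_iff_bijective.1 hinj), fun b =>
    ⟨n b, hn b, hf b, hmin b⟩⟩

lemma sameCycle_firstReturn_iff [Finite α] {p : Perm α} {i : β → α} (hi : Function.Injective i)
    {f : Perm β} (hf : ∀ b, ∃ n, 0 < n ∧ i (f b) = (p ^ n) (i b) ∧
      ∀ m, 0 < m → m < n → (p ^ m) (i b) ∉ Set.range i) (x y : β) :
    f.SameCycle x y ↔ p.SameCycle (i x) (i y) := by
  constructor
  · refine SameCycle.rel (r := fun x y => p.SameCycle (i x) (i y))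
      ((SameCycle.equivalence p).comap i) fun b => ?_
    obtain ⟨n, -, h, -⟩ := hf b
    rw [h, sameCycle_pow_right]
  · intro h
    obtain ⟨k, hk⟩ := h.exists_nat_pow_eq
    clear h
    induction k using Nat.strong_induction_on generalizing x with
    | _ k ih =>
    rcases Nat.eq_zero_or_pos k with rfl | hk0
    · rw [hi hk]
    · obtain ⟨n, hn0, hn, hmin⟩ := hf x
      have hnk : n ≤ k := by
        by_contra! hlt
        exact hmin k hk0 hlt ⟨y, hk.symm⟩
      have h2 := ih (k - n) (by omega) (f x) (by
        rw [hn, ← mul_apply, ← pow_add, Nat.sub_add_cancel hnk, hk])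
      exact sameCycle_apply_left.1 h2

end Equiv.Perm

namespace SimpleGraph

variable {V : Type u} {G : SimpleGraph V}

/-! ### Euler's inequality for rotation systems -/

instance finite_dart [Finite V] : Finite G.Dart :=
  Finite.of_injective _ Dart.toProd_injective

/-- The permutation of the darts which reverses every dart. -/
def flipPerm (G : SimpleGraph V) : Equiv.Perm G.Dart :=
  Function.Involutive.toPerm Dart.symm Dart.symm_involutive

lemma flipPerm_apply (d : G.Dart) : G.flipPerm d = d.symm := rfl

lemma exists_dart_of_not_isIsolated {v : V} (h : ¬ G.IsIsolated v) : ∃ d : G.Dart, d.fst = v := by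
  simp only [IsIsolated, not_forall, not_not] at h
  obtain ⟨w, hw⟩ := h
  exact ⟨⟨(v, w), hw⟩, rfl⟩

lemma card_dart_eq [Finite V] (G : SimpleGraph V) : Nat.card G.Dart = 2 * G.edgeSet.ncard := by
  classical
  have := Fintype.ofFinite V
  rw [Nat.card_eq_fintype_card, dart_card_eq_twice_card_edges, Set.ncard_eq_toFinset_card']
  rfl

lemma ncard_edgeSet_le_numCycles [Finite V] (G : SimpleGraph V) :
    G.edgeSet.ncard ≤ G.flipPerm.numCycles := by
  rw [← Nat.card_coe_set_eq]
  refine Nat.card_le_card_of_surjective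
    (Quotient.lift (fun d : G.Dart => (⟨d.edge, d.edge_mem⟩ : G.edgeSet)) fun x y hxy =>
      Equiv.Perm.SameCycle.map_eq (fun d : G.Dart => (⟨d.edge, d.edge_mem⟩ : G.edgeSet))
        (fun d => ?_) hxy) ?_
  · simp [flipPerm_apply]
  · rintro ⟨e, he⟩
    induction e using Sym2.ind with
    | _ x y => exact ⟨Quotient.mk _ ⟨(x, y), he⟩, rfl⟩

namespace RotationSystem

variable (R : RotationSystem G)

lemma facePerm_apply (d : G.Dart) : R.facePerm d = R.next d.symm := rfl

lemma next_eq_facePerm (d : G.Dart) : R.next d = R.facePerm d.symm := by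
  rw [facePerm_apply, Dart.symm_symm]

lemma fst_next (d : G.Dart) : (R.next d).fst = d.fst :=
  ((R.sameCycle_iff _ _).1 (Equiv.Perm.sameCycle_apply_right.2
    (Equiv.Perm.SameCycle.refl _ _))).symm

lemma fst_facePerm (d : G.Dart) : (R.facePerm d).fst = d.snd := R.fst_next d.symm

lemma card_le [Finite V] : Nat.card V ≤ R.next.numCycles + {v | G.IsIsolated v}.ncard := by
  rw [Equiv.Perm.numCycles, ← Nat.card_coe_set_eq, ← Nat.card_sum]
  refine Nat.card_le_card_of_surjective (Sum.elim
    (Quotient.lift (fun d : G.Dart => d.fst) fun x y hxy => (R.sameCycle_iff _ _).1 hxy)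
    Subtype.val) fun v => ?_
  by_cases h : G.IsIsolated v
  · exact ⟨.inr ⟨v, h⟩, rfl⟩
  · obtain ⟨d, rfl⟩ := exists_dart_of_not_isIsolated h
    exact ⟨.inl (Quotient.mk _ d), rfl⟩

lemma orbitSetoid_of_reachable {d e : G.Dart} (h : G.Reachable d.fst e.fst) :
    Equiv.Perm.orbitSetoid R.next G.flipPerm d e := by
  have hv : ∀ d e : G.Dart, d.fst = e.fst →
      Equiv.Perm.orbitSetoid R.next G.flipPerm d e := fun d e hde =>
    Equiv.Perm.SameCycle.rel (Equiv.Perm.orbitSetoid R.next G.flipPerm).iseqv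
      (Equiv.Perm.orbitSetoid_left _ _) ((R.sameCycle_iff _ _).2 hde)
  obtain ⟨p⟩ := h
  suffices H : ∀ u v : V, G.Walk u v → ∀ d e : G.Dart, d.fst = u → e.fst = v →
      Equiv.Perm.orbitSetoid R.next G.flipPerm d e from H _ _ p d e rfl rfl
  intro u v p
  induction p with
  | nil => exact fun d e h1 h2 => hv d e (h1.trans h2.symm)
  | @cons u w v h p ih =>
    intro d e h1 h2
    refine Setoid.trans' _ (hv d ⟨(u, w), h⟩ h1) (Setoid.trans' _
      (Equiv.Perm.orbitSetoid_right R.next G.flipPerm _) (ih _ e rfl h2))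

lemma numOrbits_add_le [Finite V] :
    Equiv.Perm.numOrbits R.next G.flipPerm + {v | G.IsIsolated v}.ncard ≤
      Nat.card G.ConnectedComponent := by
  rw [Equiv.Perm.numOrbits, ← Nat.card_coe_set_eq, ← Nat.card_sum]
  have hle : Equiv.Perm.orbitSetoid R.next G.flipPerm ≤
      Setoid.ker fun d : G.Dart => G.connectedComponentMk d.fst := by
    refine Equiv.Perm.orbitSetoid_le (fun d => ?_) fun d => ?_
    · simp only [Setoid.ker_def, fst_next]
    · exact ConnectedComponent.sound d.adj.reachable
  refine Nat.card_le_card_of_injective (Sum.elim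
    (Quotient.lift (fun d : G.Dart => G.connectedComponentMk d.fst) fun x y hxy => hle hxy)
    (fun v => G.connectedComponentMk v.1)) ?_
  -- an isolated vertex is not connected to any other vertex
  have hiso : ∀ v w, G.IsIsolated v → G.Reachable v w → v = w := by
    rintro v w hv ⟨p⟩
    cases p with
    | nil => rfl
    | cons h _ => exact absurd h (hv _)
  refine Function.Injective.sumElim ?_ ?_ ?_
  · intro q q' h
    induction q using Quotient.inductionOn with
    | h a =>
    induction q' using Quotient.inductionOn with
    | h b => exact Quotient.sound (R.orbitSetoid_of_reachable (ConnectedComponent.exact h))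
  · rintro ⟨v, hv⟩ ⟨w, hw⟩ h
    exact Subtype.ext (hiso v w hv (ConnectedComponent.exact h))
  · rintro q ⟨v, hv⟩ h
    induction q using Quotient.inductionOn with
    | h a =>
    have := hiso v _ hv (ConnectedComponent.exact h).symm
    exact hv a.snd (this ▸ a.adj)

/-- Euler's inequality: the surface described by a rotation system has no negative genus. -/
theorem euler_le [Finite V] :
    Nat.card V + R.numFaces ≤ G.edgeSet.ncard + 2 * Nat.card G.ConnectedComponent := by
  classical
  have h1 := R.card_le
  have h2 := R.numOrbits_add_le
  have h3 := Equiv.Perm.numCycles_add_le R.next G.flipPerm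
  have h4 := G.card_dart_eq
  have h5 := G.ncard_edgeSet_le_numCycles
  have h6 : R.numFaces = (R.next * G.flipPerm).numCycles + {v | G.IsIsolated v}.ncard := rfl
  omega

/-- Only one of the two inequalities has to be checked in order to see that a rotation system
describes an embedding in the sphere. -/
lemma isSpherical_of_le [Finite V]
    (h : G.edgeSet.ncard + 2 * Nat.card G.ConnectedComponent ≤ Nat.card V + R.numFaces) :
    R.IsSpherical :=
  le_antisymm R.euler_le h

end RotationSystem

/-! ### Subgraphs of planar graphs -/

lemma IsPlanar.deleteEdge [Finite V] (hG : G.IsPlanar) (d : G.Dart) :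
    (G.deleteEdges {d.edge}).IsPlanar := by
  classical
  obtain ⟨R, hR⟩ := hG
  set G' := G.deleteEdges {d.edge} with hG'
  have hadj : ∀ x y, G'.Adj x y ↔ G.Adj x y ∧ s(x, y) ≠ d.edge := fun x y => by
    simp [hG', deleteEdges_adj]
  let i : G'.Dart → G.Dart := fun x => ⟨x.toProd, ((hadj _ _).1 x.adj).1⟩
  have hi : Function.Injective i := fun x y h =>
    Dart.ext _ _ (congrArg (fun z : G.Dart => z.toProd) h)
  have hrange : ∀ x : G.Dart, x ∈ Set.range i ↔ x ≠ d ∧ x ≠ d.symm := by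
    intro x
    rw [← not_or, ← dart_edge_eq_iff]
    constructor
    · rintro ⟨y, rfl⟩
      exact ((hadj _ _).1 y.adj).2
    · exact fun h => ⟨⟨x.toProd, (hadj _ _).2 ⟨x.adj, h⟩⟩, rfl⟩
  obtain ⟨τ, hτ⟩ : ∃ τ, τ = Equiv.swap d (G.flipPerm d) * G.flipPerm := ⟨_, rfl⟩
  have hτ1 : ∀ x, x ∉ Set.range i → τ x = x := by
    intro x hx
    rw [hrange, not_and_or, not_not, not_not] at hx
    rcases hx with rfl | rfl
    · simp [hτ]
    · simp [hτ, flipPerm_apply]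
  have hτ2 : ∀ x, x ∈ Set.range i → τ x = x.symm := by
    intro x hx
    rw [hrange] at hx
    rw [hτ, Equiv.Perm.mul_apply, flipPerm_apply, flipPerm_apply, Equiv.swap_apply_of_ne_of_ne]
    · exact fun h => hx.2 (by rw [← h, Dart.symm_symm])
    · exact fun h => hx.1 (Dart.symm_involutive.injective h)
  obtain ⟨f, hf⟩ := Equiv.Perm.exists_firstReturn R.next i hi
  let R' : RotationSystem G' := ⟨f, fun x y => by
    rw [Equiv.Perm.sameCycle_firstReturn_iff hi hf, R.sameCycle_iff]⟩
  refine ⟨R', R'.isSpherical_of_le ?_⟩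
  have h1 := R.numOrbits_add_le
  have h2 : (R.next * G.flipPerm).numCycles + 2 * Equiv.Perm.numOrbits R.next τ ≤
      (R.next * τ).numCycles + 2 * Equiv.Perm.numOrbits R.next G.flipPerm + 1 := by
    rw [hτ]
    exact Equiv.Perm.numCycles_mul_add_numOrbits_le R.next G.flipPerm (d := d) d.symm_ne
  have h3 : R.numFaces = (R.next * G.flipPerm).numCycles + {v | G.IsIsolated v}.ncard := rfl
  have h3' : R'.numFaces = R'.facePerm.numCycles + {v | G'.IsIsolated v}.ncard := rfl
  have h4 : G'.edgeSet.ncard + 1 = G.edgeSet.ncard := by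
    rw [hG', edgeSet_deleteEdges]
    exact Set.ncard_sdiff_singleton_add_one d.edge_mem
  have hisoG : ∀ v, G.IsIsolated v → G'.IsIsolated v := fun v hv w hw => hv w ((hadj _ _).1 hw).1
  -- faces of the smaller graph
  have h5 : (R.next * τ).numCycles + {v | G.IsIsolated v}.ncard ≤
      R'.facePerm.numCycles + {v | G'.IsIsolated v}.ncard := by
    have hwd : ∀ x y : G'.Dart, R'.facePerm.SameCycle x y →
        (R.next * τ).SameCycle (i x) (i y) := by
      intro x y
      refine Equiv.Perm.SameCycle.rel (r := fun x y => (R.next * τ).SameCycle (i x) (i y))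
        ((Equiv.Perm.SameCycle.equivalence _).comap i) fun b => ?_
      obtain ⟨n, hn0, hn, hmin⟩ := hf b.symm
      have key : ∀ m, 0 < m → m ≤ n → ((R.next * τ) ^ m) (i b) = (R.next ^ m) (i b.symm) := by
        intro m hm0 hmn
        induction m with
        | zero => omega
        | succ m ih =>
          rw [pow_succ', pow_succ', Equiv.Perm.mul_apply, Equiv.Perm.mul_apply]
          rcases Nat.eq_zero_or_pos m with rfl | hm
          · simp only [pow_zero, Equiv.Perm.one_apply]
            rw [hτ2 _ ⟨b, rfl⟩]
            rfl
          · rw [ih hm (by omega), hτ1 _ (hmin m hm (by omega)), Equiv.Perm.mul_apply]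
      change (R.next * τ).SameCycle (i b) (i (f b.symm))
      rw [hn, ← key n hn0 le_rfl, Equiv.Perm.sameCycle_pow_right]
    rw [Equiv.Perm.numCycles, Equiv.Perm.numCycles, ← Nat.card_coe_set_eq, ← Nat.card_coe_set_eq,
      ← Nat.card_sum, ← Nat.card_sum]
    refine Nat.card_le_card_of_surjective (Sum.elim
      (Quotient.lift (fun x => .inl (Quotient.mk _ (i x))) fun x y hxy =>
        congrArg Sum.inl (Quotient.sound (hwd x y hxy)))
      (fun v => if h : G.IsIsolated v.1 then .inr ⟨v.1, h⟩ else
        .inl (Quotient.mk _ (exists_dart_of_not_isIsolated h).choose))) ?_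
    rintro (q | ⟨v, hv⟩)
    · induction q using Quotient.inductionOn with
      | h x =>
      by_cases hx : ∃ n : ℕ, ((R.next * τ) ^ n) x ∈ Set.range i
      · obtain ⟨n, y, hy⟩ := hx
        refine ⟨.inl (Quotient.mk _ y), congrArg Sum.inl (Quotient.sound ?_)⟩
        rw [hy]
        exact Equiv.Perm.sameCycle_pow_left.2 (Equiv.Perm.SameCycle.refl _ _)
      · push Not at hx
        have key : ∀ n : ℕ, ((R.next * τ) ^ n) x = (R.next ^ n) x := by
          intro n
          induction n with
          | zero => rfl
          | succ n ih =>
            rw [pow_succ', Equiv.Perm.mul_apply, Equiv.Perm.mul_apply, hτ1 _ (hx n), ih, pow_succ',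
              Equiv.Perm.mul_apply]
        have hsame : ∀ y : G.Dart, x.fst = y.fst → ∃ n : ℕ, ((R.next * τ) ^ n) x = y := by
          intro y hy
          obtain ⟨n, hn⟩ := ((R.sameCycle_iff x y).2 hy).exists_nat_pow_eq
          exact ⟨n, (key n).trans hn⟩
        have hiso : G'.IsIsolated x.fst := fun w hw => by
          obtain ⟨n, hn⟩ := hsame (i ⟨(x.fst, w), hw⟩) rfl
          exact hx n ⟨_, hn.symm⟩
        have hniso : ¬ G.IsIsolated x.fst := fun h => h _ x.adj
        refine ⟨.inr ⟨x.fst, hiso⟩, ?_⟩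
        simp only [Sum.elim_inr, dif_neg hniso]
        obtain ⟨n, hn⟩ := hsame _ (exists_dart_of_not_isIsolated hniso).choose_spec.symm
        rw [← hn]
        exact congrArg Sum.inl (Quotient.sound
          (Equiv.Perm.sameCycle_pow_left.2 (Equiv.Perm.SameCycle.refl _ _)))
    · refine ⟨.inr ⟨v, hisoG v hv⟩, ?_⟩
      have hv' : G.IsIsolated v := hv
      simp [hv']
  -- components of the smaller graph
  have h6 : Nat.card G'.ConnectedComponent ≤
      Equiv.Perm.numOrbits R.next τ + {v | G.IsIsolated v}.ncard := by
    rw [Equiv.Perm.numOrbits, ← Nat.card_coe_set_eq, ← Nat.card_sum]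
    have hle : Equiv.Perm.orbitSetoid R.next τ ≤
        Setoid.ker fun d : G.Dart => G'.connectedComponentMk d.fst := by
      refine Equiv.Perm.orbitSetoid_le (fun x => ?_) fun x => ?_
      · simp only [Setoid.ker_def, R.fst_next]
      · by_cases hx : x ∈ Set.range i
        · rw [hτ2 x hx]
          obtain ⟨y, rfl⟩ := hx
          exact ConnectedComponent.sound y.adj.reachable
        · rw [hτ1 x hx]
    refine Nat.card_le_card_of_surjective (Sum.elim
      (Quotient.lift (fun d : G.Dart => G'.connectedComponentMk d.fst) fun x y hxy => hle hxy)
      (fun v => G'.connectedComponentMk v.1)) fun C => ?_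
    induction C using ConnectedComponent.ind with
    | _ v =>
    by_cases h : G.IsIsolated v
    · exact ⟨.inr ⟨v, h⟩, rfl⟩
    · obtain ⟨x, rfl⟩ := exists_dart_of_not_isIsolated h
      exact ⟨.inl (Quotient.mk _ x), rfl⟩
  have h7 : Nat.card V + R.numFaces = G.edgeSet.ncard + 2 * Nat.card G.ConnectedComponent := hR
  omega

theorem IsPlanar.mono [Finite V] {G G' : SimpleGraph V} (hG : G.IsPlanar) (hle : G' ≤ G) :
    G'.IsPlanar := by
  induction hn : G.edgeSet.ncard using Nat.strong_induction_on generalizing G with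
  | _ n ih =>
  by_cases h : G ≤ G'
  · rwa [le_antisymm hle h]
  · simp only [le_iff_adj, not_forall] at h
    obtain ⟨x, y, hxy, hxy'⟩ := h
    refine ih _ ?_ (hG.deleteEdge ⟨(x, y), hxy⟩) ?_ rfl
    · rw [← hn, edgeSet_deleteEdges]
      exact Set.ncard_sdiff_singleton_lt_of_mem hxy
    · intro u v huv
      rw [deleteEdges_adj]
      refine ⟨hle huv, fun h => hxy' ?_⟩
      have h : s(u, v) = s(x, y) := h
      rw [← mem_edgeSet, ← h]
      exact huv

end SimpleGraph

/-! ### Triangles as Jordan curves -/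

lemma Equiv.Perm.SameCycle.congr_perm {α : Type*} [Finite α] {p q : Equiv.Perm α} {x y : α}
    (h : ∀ z, p.SameCycle x z → q z = p z) (H : p.SameCycle x y) : q.SameCycle x y := by
  obtain ⟨n, rfl⟩ := H.exists_nat_pow_eq
  refine ⟨n, ?_⟩
  rw [zpow_natCast]
  clear H
  induction n with
  | zero => rfl
  | succ n ih =>
    rw [pow_succ', Equiv.Perm.mul_apply, ih, h _ (by simp [SameCycle.rfl]), pow_succ',
      Equiv.Perm.mul_apply]

namespace SimpleGraph

variable {V : Type u} {G : SimpleGraph V}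

/-- `x y z` is the boundary of a triangular face, traced in this direction. -/
def RotationSystem.IsFace (R : RotationSystem G) (x y z : V) : Prop :=
  ∃ (h₁ : G.Adj x y) (h₂ : G.Adj y z) (h₃ : G.Adj z x),
    R.facePerm ⟨(x, y), h₁⟩ = ⟨(y, z), h₂⟩ ∧ R.facePerm ⟨(y, z), h₂⟩ = ⟨(z, x), h₃⟩ ∧
      R.facePerm ⟨(z, x), h₃⟩ = ⟨(x, y), h₁⟩

/-- `τ` exchanges, at each corner of the triangle `a b c`, the two darts along the triangle, and
fixes all other darts.  If `σ` is a rotation system and `α` the reversal of darts then `σ * τ` and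
`τ * α` describe the surface cut open along the triangle: the rotation at each corner is split into
its parts on the two sides of the triangle, the three edges of the triangle become two
hyperedges with three darts each, and the faces, the cycles of `σ * τ * (τ * α)`, are unchanged. -/
structure IsCut (τ : Equiv.Perm G.Dart) {a b c : V} (hab : G.Adj a b) (hbc : G.Adj b c)
    (hca : G.Adj c a) : Prop where
  ab : τ ⟨(a, b), hab⟩ = ⟨(a, c), hca.symm⟩
  ac : τ ⟨(a, c), hca.symm⟩ = ⟨(a, b), hab⟩
  bc : τ ⟨(b, c), hbc⟩ = ⟨(b, a), hab.symm⟩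
  ba : τ ⟨(b, a), hab.symm⟩ = ⟨(b, c), hbc⟩
  ca : τ ⟨(c, a), hca⟩ = ⟨(c, b), hbc.symm⟩
  cb : τ ⟨(c, b), hbc.symm⟩ = ⟨(c, a), hca⟩
  fix : ∀ x : G.Dart, ¬ (x.fst ∈ ({a, b, c} : Set V) ∧ x.snd ∈ ({a, b, c} : Set V)) → τ x = x

namespace IsCut

variable {τ : Equiv.Perm G.Dart} {a b c : V} {hab : G.Adj a b} {hbc : G.Adj b c}
  {hca : G.Adj c a}

lemma rotate (h : IsCut τ hab hbc hca) : IsCut τ hbc hca hab where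
  ab := h.bc
  ac := h.ba
  bc := h.ca
  ba := h.cb
  ca := h.ab
  cb := h.ac
  fix x hx := h.fix x fun hx' => hx (by simp only [Set.mem_insert_iff] at hx' ⊢; tauto)

lemma reverse (h : IsCut τ hab hbc hca) : IsCut τ hab.symm hca.symm hbc.symm where
  ab := h.ba
  ac := h.bc
  bc := h.ac
  ba := h.ab
  ca := h.cb
  cb := h.ca
  fix x hx := h.fix x fun hx' => hx (by simp only [Set.mem_insert_iff] at hx' ⊢; tauto)

lemma cases (h : IsCut τ hab hbc hca) {p : G.Dart → Prop} (h₁ : p ⟨(a, b), hab⟩)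
    (h₂ : p ⟨(a, c), hca.symm⟩) (h₃ : p ⟨(b, c), hbc⟩) (h₄ : p ⟨(b, a), hab.symm⟩)
    (h₅ : p ⟨(c, a), hca⟩) (h₆ : p ⟨(c, b), hbc.symm⟩) (h₇ : ∀ x, τ x = x → p x) (x : G.Dart) :
    p x := by
  by_cases hx : x.fst ∈ ({a, b, c} : Set V) ∧ x.snd ∈ ({a, b, c} : Set V)
  · obtain ⟨⟨u, v⟩, huv⟩ := x
    have hu : u = a ∨ u = b ∨ u = c := hx.1
    have hv : v = a ∨ v = b ∨ v = c := hx.2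
    rcases hu with rfl | rfl | rfl <;> rcases hv with rfl | rfl | rfl <;>
      first | assumption | exact absurd rfl huv.ne
  · exact h₇ x (h.fix x hx)

lemma mul_self (h : IsCut τ hab hbc hca) : τ * τ = 1 := by
  ext1 x
  revert x
  refine h.cases ?_ ?_ ?_ ?_ ?_ ?_ fun x hx => by simp [hx]
  all_goals simp [h.ab, h.ac, h.bc, h.ba, h.ca, h.cb]

/-- The orbits of the surface which is cut open along the triangle. -/
local notation "cutSetoid" R:max τ:max =>
  Equiv.Perm.orbitSetoid (RotationSystem.next R * τ) (τ * flipPerm _)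

variable (R : RotationSystem G)

lemma orbit_ab_bc (h : IsCut τ hab hbc hca) :
    (cutSetoid R τ) ⟨(a, b), hab⟩ ⟨(b, c), hbc⟩ := by
  have := Equiv.Perm.orbitSetoid_right (R.next * τ) (τ * G.flipPerm) ⟨(a, b), hab⟩
  have e : (τ * G.flipPerm) ⟨(a, b), hab⟩ = ⟨(b, c), hbc⟩ := h.ba
  rwa [e] at this

/-- If the corner of the triangle at `b` is not the corner of a face then the side of the triangle
on which this corner lies contains a vertex. -/
lemma exists_of_facePerm_ne (h : IsCut τ hab hbc hca)
    (hne : ¬ (cutSetoid R τ) ⟨(a, b), hab⟩ ⟨(b, a), hab.symm⟩)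
    (hface : R.facePerm ⟨(a, b), hab⟩ ≠ ⟨(b, c), hbc⟩) :
    ∃ x : G.Dart, (cutSetoid R τ) ⟨(a, b), hab⟩ x ∧ x.fst ∉ ({a, b, c} : Set V) := by
  set s := (cutSetoid R τ) with hs
  set r := R.facePerm ⟨(a, b), hab⟩ with hr
  have hr1 : s ⟨(a, b), hab⟩ r := by
    refine s.trans' (h.orbit_ab_bc R) ?_
    have := Equiv.Perm.orbitSetoid_left (R.next * τ) (τ * G.flipPerm) ⟨(b, c), hbc⟩
    rwa [Equiv.Perm.mul_apply, h.bc] at this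
  have hfst : r.fst = b := R.fst_facePerm _
  have hsnd : r.snd ∉ ({a, b, c} : Set V) := by
    rintro (h' | h' | h')
    · refine hne ?_
      have : r = ⟨(b, a), hab.symm⟩ := Dart.ext _ _ (Prod.ext hfst h')
      rwa [← this]
    · exact r.fst_ne_snd (hfst.trans h'.symm)
    · exact hface (Dart.ext _ _ (Prod.ext hfst h'))
  refine ⟨r.symm, s.trans' hr1 ?_, hsnd⟩
  have := Equiv.Perm.orbitSetoid_right (R.next * τ) (τ * G.flipPerm) r
  rwa [Equiv.Perm.mul_apply, flipPerm_apply, h.fix r.symm fun h' => hsnd h'.1] at this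

lemma exists_of_not_isFace (h : IsCut τ hab hbc hca)
    (hne : ¬ (cutSetoid R τ) ⟨(a, b), hab⟩ ⟨(b, a), hab.symm⟩) (hface : ¬ R.IsFace a b c) :
    ∃ x : G.Dart, (cutSetoid R τ) ⟨(a, b), hab⟩ x ∧ x.fst ∉ ({a, b, c} : Set V) := by
  set s := (cutSetoid R τ) with hs
  have h1 : s ⟨(a, b), hab⟩ ⟨(b, c), hbc⟩ := h.orbit_ab_bc R
  have h2 : s ⟨(b, c), hbc⟩ ⟨(c, a), hca⟩ := h.rotate.orbit_ab_bc R
  have h3 : s ⟨(b, a), hab.symm⟩ ⟨(a, c), hca.symm⟩ := h.reverse.orbit_ab_bc R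
  have h4 : s ⟨(a, c), hca.symm⟩ ⟨(c, b), hbc.symm⟩ := h.reverse.rotate.orbit_ab_bc R
  by_contra! hcon
  have key : ∀ x, s ⟨(a, b), hab⟩ x → x.fst ∈ ({a, b, c} : Set V) := hcon
  refine hface ⟨hab, hbc, hca, ?_, ?_, ?_⟩ <;> by_contra hc
  · obtain ⟨x, hx, hx'⟩ := h.exists_of_facePerm_ne R hne hc
    exact hx' (key x hx)
  · have hne' : ¬ s ⟨(b, c), hbc⟩ ⟨(c, b), hbc.symm⟩ := fun h' =>
      hne (s.trans' (s.trans' h1 h') (s.symm' (s.trans' h3 h4)))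
    obtain ⟨x, hx, hx'⟩ := h.rotate.exists_of_facePerm_ne R hne' hc
    have := key x (s.trans' h1 hx)
    simp only [Set.mem_insert_iff, Set.mem_singleton_iff] at hx' this
    tauto
  · have hne' : ¬ s ⟨(c, a), hca⟩ ⟨(a, c), hca.symm⟩ := fun h' =>
      hne (s.trans' (s.trans' (s.trans' h1 h2) h') (s.symm' h3))
    obtain ⟨x, hx, hx'⟩ := h.rotate.rotate.exists_of_facePerm_ne R hne' hc
    have := key x (s.trans' (s.trans' h1 h2) hx)
    simp only [Set.mem_insert_iff, Set.mem_singleton_iff] at hx' this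
    tauto

end IsCut

set_option linter.unusedSimpArgs false in
/-- There is a permutation which cuts the surface open along a given triangle, and by the genus
inequality the cut increases the number of components. -/
lemma RotationSystem.IsSpherical.exists_isCut [Finite V] {R : RotationSystem G}
    (hR : R.IsSpherical) {a b c : V} (hab : G.Adj a b) (hbc : G.Adj b c) (hca : G.Adj c a) :
    ∃ τ, IsCut τ hab hbc hca ∧ ¬ Equiv.Perm.orbitSetoid (R.next * τ) (τ * G.flipPerm)
      ⟨(a, b), hab⟩ ⟨(b, a), hab.symm⟩ := by
  classical
  set ab : G.Dart := ⟨(a, b), hab⟩ with hab'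
  set ba : G.Dart := ⟨(b, a), hab.symm⟩ with hba'
  set bc : G.Dart := ⟨(b, c), hbc⟩ with hbc'
  set cb : G.Dart := ⟨(c, b), hbc.symm⟩ with hcb'
  set ca : G.Dart := ⟨(c, a), hca⟩ with hca'
  set ac : G.Dart := ⟨(a, c), hca.symm⟩ with hac'
  have n1 := hab.ne
  have n2 := hbc.ne
  have n3 := hca.ne
  have n1' := n1.symm
  have n2' := n2.symm
  have n3' := n3.symm
  obtain ⟨τ, hτ⟩ : ∃ τ, τ = Equiv.swap ab ac * Equiv.swap bc ba * Equiv.swap ca cb := ⟨_, rfl⟩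
  have hcut : IsCut τ hab hbc hca := by
    constructor
    case fix =>
      intro x hx
      have key : ∀ (u v : V) (h : G.Adj u v), u ∈ ({a, b, c} : Set V) → v ∈ ({a, b, c} : Set V) →
          x ≠ ⟨(u, v), h⟩ := by
        rintro u v h hu hv rfl
        exact hx ⟨hu, hv⟩
      have h1 : x ≠ ab := key _ _ _ (by simp) (by simp)
      have h2 : x ≠ ac := key _ _ _ (by simp) (by simp)
      have h3 : x ≠ bc := key _ _ _ (by simp) (by simp)
      have h4 : x ≠ ba := key _ _ _ (by simp) (by simp)
      have h5 : x ≠ ca := key _ _ _ (by simp) (by simp)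
      have h6 : x ≠ cb := key _ _ _ (by simp) (by simp)
      rw [hτ, Equiv.Perm.mul_apply, Equiv.Perm.mul_apply, Equiv.swap_apply_of_ne_of_ne h5 h6,
        Equiv.swap_apply_of_ne_of_ne h3 h4, Equiv.swap_apply_of_ne_of_ne h1 h2]
    all_goals
      simp only [hτ, Equiv.Perm.mul_apply, Equiv.swap_apply_def, ab, ba, bc, cb, ca, ac,
        Dart.ext_iff, Prod.mk.injEq]
      simp [n1, n2, n3, n1', n2', n3']
  refine ⟨τ, hcut, fun hs => ?_⟩
  -- the number of vertices grows by three
  have hv : R.next.numCycles + 3 ≤ (R.next * τ).numCycles := by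
    have h1 : R.next.SameCycle ab ac := (R.sameCycle_iff _ _).2 rfl
    have h2 : (R.next * Equiv.swap ab ac).SameCycle bc ba := by
      refine Equiv.Perm.SameCycle.congr_perm (fun z hz => ?_)
        ((R.sameCycle_iff bc ba).2 rfl)
      have hz : b = z.fst := (R.sameCycle_iff _ _).1 hz
      rw [Equiv.Perm.mul_apply, Equiv.swap_apply_of_ne_of_ne]
      · rintro rfl; exact n1' hz
      · rintro rfl; exact n1' hz
    have h3 : (R.next * Equiv.swap ab ac * Equiv.swap bc ba).SameCycle ca cb := by
      refine Equiv.Perm.SameCycle.congr_perm (fun z hz => ?_)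
        ((R.sameCycle_iff ca cb).2 rfl)
      have hz : c = z.fst := (R.sameCycle_iff _ _).1 hz
      rw [Equiv.Perm.mul_apply, Equiv.Perm.mul_apply, Equiv.swap_apply_of_ne_of_ne (x := z),
        Equiv.swap_apply_of_ne_of_ne]
      · rintro rfl; exact n3 hz
      · rintro rfl; exact n3 hz
      · rintro rfl; exact n2' hz
      · rintro rfl; exact n2' hz
    have k1 := h1.numCycles_mul_swap (by simp [ab, ac, n2])
    have k2 := h2.numCycles_mul_swap (by simp [bc, ba, n3])
    have k3 := h3.numCycles_mul_swap (by simp [ca, cb, n1])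
    rw [hτ, ← mul_assoc, ← mul_assoc]
    omega
  -- three edges turn into two hyperedges
  have he : G.flipPerm.numCycles ≤ (τ * G.flipPerm).numCycles + 1 := by
    have hmul : τ * G.flipPerm =
        G.flipPerm * Equiv.swap ba ca * Equiv.swap cb ab * Equiv.swap ac bc := by
      have hsw : ∀ x y : G.Dart, Equiv.swap x y * G.flipPerm =
          G.flipPerm * Equiv.swap x.symm y.symm := fun x y => Equiv.swap_mul_eq_mul_swap _ _ _
      rw [hτ, mul_assoc, hsw, ← mul_assoc, mul_assoc (Equiv.swap ab ac), hsw, ← mul_assoc, hsw]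
      rfl
    have k1 := Equiv.Perm.numCycles_le_mul_swap G.flipPerm ba ca
    have k2 := Equiv.Perm.numCycles_le_mul_swap (G.flipPerm * Equiv.swap ba ca) cb ab
    have h3 : (G.flipPerm * Equiv.swap ba ca * Equiv.swap cb ab).SameCycle bc ac := by
      refine ⟨3, ?_⟩
      have e1 : (G.flipPerm * Equiv.swap ba ca * Equiv.swap cb ab) bc = cb := by
        simp only [Equiv.Perm.mul_apply, Equiv.swap_apply_def, flipPerm_apply, ab, ba, bc, cb, ca,
          Dart.ext_iff, Prod.mk.injEq]
        simp [n1, n2, n3, n1', n2', n3']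
      have e2 : (G.flipPerm * Equiv.swap ba ca * Equiv.swap cb ab) cb = ba := by
        simp only [Equiv.Perm.mul_apply, Equiv.swap_apply_def, flipPerm_apply, ab, ba, bc, cb, ca,
          Dart.ext_iff, Prod.mk.injEq]
        simp [n1, n2, n3, n1', n2', n3']
      have e3 : (G.flipPerm * Equiv.swap ba ca * Equiv.swap cb ab) ba = ac := by
        simp only [Equiv.Perm.mul_apply, Equiv.swap_apply_def, flipPerm_apply, ab, ba, bc, cb, ca,
          ac, Dart.ext_iff, Prod.mk.injEq]
        simp [n1, n2, n3, n1', n2', n3']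
      rw [show (3 : ℤ) = 1 + (1 + 1) from rfl, zpow_one_add, zpow_one_add, zpow_one,
        Equiv.Perm.mul_apply (_ * _ * _) (_ * _), Equiv.Perm.mul_apply (_ * _ * _) (_ * _ * _), e1,
        e2, e3]
    have k3 := h3.symm.numCycles_mul_swap (by simp [bc, ac, n1])
    rw [hmul]
    omega
  -- without an increase of the number of components, the genus inequality would fail
  have ho : Equiv.Perm.numOrbits (R.next * τ) (τ * G.flipPerm) ≤
      Equiv.Perm.numOrbits R.next G.flipPerm := by
    set s := Equiv.Perm.orbitSetoid (R.next * τ) (τ * G.flipPerm) with hs'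
    have h1 : s ab bc := hcut.orbit_ab_bc R
    have h2 : s bc ca := hcut.rotate.orbit_ab_bc R
    have h3 : s ba ac := hcut.reverse.orbit_ab_bc R
    have h4 : s ac cb := hcut.reverse.rotate.orbit_ab_bc R
    have hτs : ∀ x, s x (τ x) := by
      refine hcut.cases ?_ ?_ ?_ ?_ ?_ ?_ fun x hx => by rw [hx]
      · rw [hcut.ab]; exact s.trans' hs h3
      · rw [hcut.ac]; exact s.symm' (s.trans' hs h3)
      · rw [hcut.bc]; exact s.trans' (s.symm' h1) hs
      · rw [hcut.ba]; exact s.symm' (s.trans' (s.symm' h1) hs)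
      · rw [hcut.ca]
        exact s.trans' (s.symm' (s.trans' h1 h2)) (s.trans' hs (s.trans' h3 h4))
      · rw [hcut.cb]
        exact s.symm' (s.trans' (s.symm' (s.trans' h1 h2)) (s.trans' hs (s.trans' h3 h4)))
    have hττ : ∀ x, τ (τ x) = x := fun x => by
      rw [← Equiv.Perm.mul_apply, hcut.mul_self, Equiv.Perm.one_apply]
    have hle : Equiv.Perm.orbitSetoid R.next G.flipPerm ≤ s := by
      refine Equiv.Perm.orbitSetoid_le (fun x => ?_) fun x => ?_
      · have := Equiv.Perm.orbitSetoid_left (R.next * τ) (τ * G.flipPerm) (τ x)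
        rw [Equiv.Perm.mul_apply, hττ] at this
        exact s.trans' (hτs x) this
      · have := Equiv.Perm.orbitSetoid_right (R.next * τ) (τ * G.flipPerm) x
        rw [Equiv.Perm.mul_apply] at this
        exact s.trans' this (s.symm' (hτs _))
    refine Nat.card_le_card_of_surjective
      (Quotient.lift (Quotient.mk s) fun u v huv => Quotient.sound (hle huv)) ?_
    intro q
    induction q using Quotient.inductionOn with
    | h x => exact ⟨Quotient.mk _ x, rfl⟩
  have hg := Equiv.Perm.numCycles_add_le (R.next * τ) (τ * G.flipPerm)
  have hmul : R.next * τ * (τ * G.flipPerm) = R.next * G.flipPerm := by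
    rw [mul_assoc, ← mul_assoc τ, hcut.mul_self, one_mul]
  rw [hmul] at hg
  have h1 := R.card_le
  have h2 := R.numOrbits_add_le
  have h4 := G.card_dart_eq
  have h5 := G.ncard_edgeSet_le_numCycles
  have h6 : R.numFaces = (R.next * G.flipPerm).numCycles + {v | G.IsIsolated v}.ncard := rfl
  have h7 : Nat.card V + R.numFaces = G.edgeSet.ncard + 2 * Nat.card G.ConnectedComponent := hR
  omega

/-- A triangle of a graph drawn in the sphere bounds a face, in one of the two directions, or it
separates two sets of vertices both of which are incident with edges. -/
theorem RotationSystem.IsSpherical.isFace_or_separates [Finite V] {R : RotationSystem G}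
    (hR : R.IsSpherical) {a b c : V} (hab : G.Adj a b) (hbc : G.Adj b c) (hca : G.Adj c a) :
    R.IsFace a b c ∨ R.IsFace b a c ∨ ∃ A : Set V, (∀ u ∈ A, u ∉ ({a, b, c} : Set V)) ∧
      (∀ u ∈ A, ∀ v, G.Adj u v → v ∈ A ∪ {a, b, c}) ∧ (∃ u ∈ A, ∃ v, G.Adj u v) ∧
      ∃ u, u ∉ A ∪ {a, b, c} ∧ ∃ v, G.Adj u v := by
  obtain ⟨τ, hcut, hne⟩ := hR.exists_isCut hab hbc hca
  by_cases hf1 : R.IsFace a b c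
  · exact .inl hf1
  by_cases hf2 : R.IsFace b a c
  · exact .inr (.inl hf2)
  refine .inr (.inr ?_)
  obtain ⟨x, hx, hxS⟩ := hcut.exists_of_not_isFace R hne hf1
  obtain ⟨y, hy, hyS⟩ := hcut.reverse.exists_of_not_isFace R (fun h => hne (Setoid.symm' _ h)) hf2
  set s := Equiv.Perm.orbitSetoid (R.next * τ) (τ * G.flipPerm) with hs
  have hyS : y.fst ∉ ({a, b, c} : Set V) := by
    simp only [Set.mem_insert_iff, Set.mem_singleton_iff] at hyS ⊢
    tauto
  -- away from the triangle, all darts with the same tail lie on the same side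
  have hside : ∀ d e : G.Dart, d.fst ∉ ({a, b, c} : Set V) → d.fst = e.fst → s d e := by
    intro d e hd hde
    refine Equiv.Perm.SameCycle.rel s.iseqv (Equiv.Perm.orbitSetoid_left _ _)
      (Equiv.Perm.SameCycle.congr_perm (fun z hz => ?_) ((R.sameCycle_iff d e).2 hde))
    rw [R.sameCycle_iff] at hz
    rw [Equiv.Perm.mul_apply, hcut.fix z fun h => hd (hz ▸ h.1)]
  refine ⟨{u | u ∉ ({a, b, c} : Set V) ∧ ∃ d : G.Dart, d.fst = u ∧ s ⟨(a, b), hab⟩ d},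
    fun u hu => hu.1, ?_, ⟨x.fst, ⟨hxS, x, rfl, hx⟩, x.snd, x.adj⟩, y.fst, ?_, y.snd, y.adj⟩
  · rintro u ⟨hu, d, rfl, hd⟩ v huv
    by_cases hv : v ∈ ({a, b, c} : Set V)
    · exact .inr hv
    refine .inl ⟨hv, ⟨(v, d.fst), huv.symm⟩, rfl, s.trans' hd ?_⟩
    refine s.trans' (hside d ⟨(d.fst, v), huv⟩ hu rfl) ?_
    have := Equiv.Perm.orbitSetoid_right (R.next * τ) (τ * G.flipPerm) ⟨(d.fst, v), huv⟩
    rwa [Equiv.Perm.mul_apply, flipPerm_apply, hcut.fix _ fun h => hv h.1] at this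
  · rintro (⟨-, d, hd, hd'⟩ | h)
    · exact hne (s.trans' (s.trans' hd' (s.symm' (hside y d hyS hd.symm))) (s.symm' hy))
    · exact hyS h

end SimpleGraph

namespace SimpleGraph

variable {V : Type u} {G : SimpleGraph V}

/-! ### Rotation systems with given faces -/

namespace RotationSystem

lemma numFaces_eq (R : RotationSystem G) :
    R.numFaces = R.facePerm.numCycles + {v | G.IsIsolated v}.ncard := rfl

/-- The rotation system with a given face tracing permutation. -/
def ofFacePerm (φ : Equiv.Perm G.Dart) (h₁ : ∀ d, (φ d).fst = d.snd)
    (h₂ : ∀ d e : G.Dart, d.fst = e.fst → (φ * G.flipPerm).SameCycle d e) : RotationSystem G where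
  next := φ * G.flipPerm
  sameCycle_iff d e := ⟨Equiv.Perm.SameCycle.map_eq (fun d : G.Dart => d.fst) fun d => by
    rw [Equiv.Perm.mul_apply, h₁]; rfl, h₂ d e⟩

lemma facePerm_ofFacePerm (φ : Equiv.Perm G.Dart) (h₁ : ∀ d, (φ d).fst = d.snd)
    (h₂ : ∀ d e : G.Dart, d.fst = e.fst → (φ * G.flipPerm).SameCycle d e) (d : G.Dart) :
    (ofFacePerm φ h₁ h₂).facePerm d = φ d := by
  simp [facePerm_apply, ofFacePerm, flipPerm_apply]

lemma facePerm_ne_self (R : RotationSystem G) (d : G.Dart) : R.facePerm d ≠ d := fun h =>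
  d.snd_ne_fst (by rw [← R.fst_facePerm d, h])

end RotationSystem

/-! ### Adding a triangle on an edge -/

/-- The graph `G` with a new vertex `none` which is adjacent to `a` and `b`. -/
def addVertex (G : SimpleGraph V) (a b : V) : SimpleGraph (Option V) where
  Adj
    | some u, some v => G.Adj u v
    | some u, none => u = a ∨ u = b
    | none, some v => v = a ∨ v = b
    | none, none => False
  symm := ⟨by
    rintro (_ | u) (_ | v) h
    exacts [h, h, h, G.adj_symm h]⟩
  loopless := ⟨by
    rintro (_ | u) h
    exacts [h, G.irrefl h]⟩

/-- The new vertex and its two edges can be drawn close to the edge between `a` and `b`. -/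
theorem IsPlanar.addVertex [Finite V] (hG : G.IsPlanar) {a b : V} (hab : G.Adj a b) :
    (G.addVertex a b).IsPlanar := by
  classical
  obtain ⟨R, hR⟩ := hG
  set H := G.addVertex a b with hH
  let ι : G.Dart → H.Dart := fun d => ⟨(some d.fst, some d.snd), d.adj⟩
  obtain ⟨ab, hab'⟩ : ∃ ab : G.Dart, ab = ⟨(a, b), hab⟩ := ⟨_, rfl⟩
  let ax : H.Dart := ⟨(some a, none), Or.inl rfl⟩
  let xb : H.Dart := ⟨(none, some b), Or.inr rfl⟩
  have hne : a ≠ b := hab.ne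
  have hcases : ∀ p : H.Dart → Prop, (∀ d, p (ι d)) → p ax → p xb → p xb.symm → p ax.symm →
      ∀ x, p x := by
    rintro p h1 h2 h3 h4 h5 ⟨⟨_ | u, _ | v⟩, h⟩
    · exact h.elim
    · rcases (h : v = a ∨ v = b) with rfl | rfl
      · exact h5
      · exact h3
    · rcases (h : u = a ∨ u = b) with rfl | rfl
      · exact h2
      · exact h4
    · exact h1 ⟨(u, v), h⟩
  let ψ : G.Dart ⊕ Fin 4 → H.Dart := Sum.elim ι ![ax, xb, xb.symm, ax.symm]
  have hψ : Function.Bijective ψ := by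
    constructor
    · rintro (d | i) (e | j) h
      · congr 1
        have h' : (ι d).toProd = (ι e).toProd := congrArg _ h
        simp only [ι, Prod.mk.injEq, Option.some.injEq] at h'
        exact Dart.ext _ _ (Prod.ext h'.1 h'.2)
      · have h' : (ι d).toProd = (ψ (.inr j)).toProd := congrArg _ h
        fin_cases j <;> simp [ψ, ι, ax, xb] at h'
      · have h' : (ψ (.inr i)).toProd = (ι e).toProd := congrArg _ h
        fin_cases i <;> simp [ψ, ι, ax, xb] at h'
      · have h' : (ψ (.inr i)).toProd = (ψ (.inr j)).toProd := congrArg _ h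
        fin_cases i <;> fin_cases j <;> simp [ψ, ax, xb, hne, hne.symm] at h' ⊢
    · refine hcases _ (fun d => ⟨.inl d, rfl⟩) ⟨.inr 0, rfl⟩ ⟨.inr 1, rfl⟩ ⟨.inr 2, rfl⟩
        ⟨.inr 3, rfl⟩
  let Ψ : G.Dart ⊕ Fin 4 ≃ H.Dart := Equiv.ofBijective ψ hψ
  -- the dart `ab` is replaced by the path through the new vertex, and bounds a new triangle
  obtain ⟨φ, e1, e2, e3, e4, e5, e6, e7⟩ : ∃ φ : Equiv.Perm H.Dart,
      (∀ d, d ≠ ab → R.facePerm d ≠ ab → φ (ι d) = ι (R.facePerm d)) ∧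
      (∀ d, R.facePerm d = ab → φ (ι d) = ax) ∧ φ ax = xb ∧ φ xb = ι (R.facePerm ab) ∧
      φ (ι ab) = xb.symm ∧ φ xb.symm = ax.symm ∧ φ ax.symm = ι ab := by
    let ρ : Equiv.Perm (G.Dart ⊕ Fin 4) := Equiv.swap (.inl ab) (.inr 0) *
      Equiv.Perm.sumCongr R.facePerm (finRotate 4) * Equiv.swap (.inl ab) (.inr 1)
    have hφ : ∀ y, (Ψ.permCongr ρ) (ψ y) = ψ (ρ y) := fun y => by
      rw [Equiv.permCongr_apply]
      exact congrArg (fun z => ψ (ρ z)) (Ψ.symm_apply_apply y)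
    have hn := R.facePerm_ne_self ab
    refine ⟨Ψ.permCongr ρ, fun d h1 h2 => (hφ (.inl d)).trans ?_, fun d h => (hφ (.inl d)).trans ?_,
      (hφ (.inr 0)).trans ?_, (hφ (.inr 1)).trans ?_, (hφ (.inl ab)).trans ?_,
      (hφ (.inr 2)).trans ?_, (hφ (.inr 3)).trans ?_⟩
    · have : ρ (.inl d) = .inl (R.facePerm d) := by
        simp [ρ, Equiv.swap_apply_def, h1, h2]
      rw [this]; rfl
    · have hd : d ≠ ab := fun h' => hn (h' ▸ h)
      have : ρ (.inl d) = .inr 0 := by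
        simp [ρ, Equiv.swap_apply_def, h, hd]
      rw [this]; rfl
    · have : ρ (.inr 0) = .inr 1 := by
        simp [ρ, Equiv.swap_apply_def]
      rw [this]; rfl
    · have : ρ (.inr 1) = .inl (R.facePerm ab) := by
        simp [ρ, Equiv.swap_apply_def, hn]
      rw [this]; rfl
    · have : ρ (.inl ab) = .inr 2 := by
        simp [ρ, Equiv.swap_apply_def]
      rw [this]; rfl
    · have : ρ (.inr 2) = .inr 3 := by
        simp [ρ, Equiv.swap_apply_def]
      rw [this]; rfl
    · have : ρ (.inr 3) = .inl ab := by
        simp [ρ, Equiv.swap_apply_def]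
      rw [this]; rfl
  have hφfst : ∀ x, (φ x).fst = x.snd := by
    refine hcases _ (fun d => ?_) (by rw [e3]) ?_ (by rw [e6]; rfl) ?_
    · by_cases h1 : d = ab
      · rw [h1, e5, hab']; rfl
      by_cases h2 : R.facePerm d = ab
      · rw [e2 d h2]
        have := R.fst_facePerm d
        rw [h2, hab'] at this
        exact congrArg some this
      · rw [e1 d h1 h2]
        exact congrArg some (R.fst_facePerm d)
    · rw [e4]
      have := R.fst_facePerm ab
      rw [hab'] at this ⊢
      exact congrArg some this
    · rw [e7, hab']; rfl
  have hsame : ∀ x y : H.Dart, x.fst = y.fst → (φ * H.flipPerm).SameCycle x y := by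
    have hstep : ∀ x, (φ * H.flipPerm).SameCycle x (φ x.symm) := fun x =>
      Equiv.Perm.sameCycle_apply_right.2 (Equiv.Perm.SameCycle.refl (φ * H.flipPerm) x)
    have hax : (φ * H.flipPerm).SameCycle ax (ι ab) := by
      have := hstep ax
      rwa [e7] at this
    have hbx : (φ * H.flipPerm).SameCycle xb.symm (ι (R.facePerm ab)) := by
      have := hstep xb.symm
      rwa [Dart.symm_symm, e4] at this
    have hxb : (φ * H.flipPerm).SameCycle ax.symm xb := by
      have := hstep ax.symm
      rwa [Dart.symm_symm, e3] at this
    have hold : ∀ d e : G.Dart, d.fst = e.fst → (φ * H.flipPerm).SameCycle (ι d) (ι e) := by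
      intro d e hde
      refine Equiv.Perm.SameCycle.rel
        (r := fun d e => (φ * H.flipPerm).SameCycle (ι d) (ι e))
        ((Equiv.Perm.SameCycle.equivalence _).comap ι) (fun d => ?_) ((R.sameCycle_iff d e).2 hde)
      rw [R.next_eq_facePerm]
      have h0 := hstep (ι d)
      change (φ * H.flipPerm).SameCycle (ι d) (φ (ι d.symm)) at h0
      by_cases h1 : d.symm = ab
      · rw [h1] at h0 ⊢
        rw [e5] at h0
        exact h0.trans hbx
      by_cases h2 : R.facePerm d.symm = ab
      · rw [e2 _ h2] at h0
        rw [h2]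
        exact h0.trans hax
      · rwa [e1 _ h1 h2] at h0
    have hrep : ∀ x : H.Dart, (∃ d, x.fst = some d.fst ∧ (φ * H.flipPerm).SameCycle x (ι d)) ∨
        (x.fst = none ∧ (φ * H.flipPerm).SameCycle x xb) := by
      refine hcases _ (fun d => .inl ⟨d, rfl, .refl _ _⟩) (.inl ⟨ab, by rw [hab'], hax⟩)
        (.inr ⟨rfl, .refl _ _⟩) (.inl ⟨_, ?_, hbx⟩) (.inr ⟨rfl, hxb⟩)
      rw [R.fst_facePerm, hab']
      rfl
    intro x y hxy
    rcases hrep x with ⟨d, hd, hd'⟩ | ⟨hx, hx'⟩ <;> rcases hrep y with ⟨e, he, he'⟩ | ⟨hy, hy'⟩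
    · rw [hxy, he, Option.some.injEq] at hd
      exact hd'.trans ((hold d e hd.symm).trans he'.symm)
    · rw [hxy, hy] at hd
      simp at hd
    · rw [hxy, he] at hx
      simp at hx
    · exact hx'.trans hy'.symm
  let R' := RotationSystem.ofFacePerm φ hφfst hsame
  have hR' : ∀ x, R'.facePerm x = φ x := RotationSystem.facePerm_ofFacePerm φ hφfst hsame
  refine ⟨R', R'.isSpherical_of_le ?_⟩
  have hV : Nat.card (Option V) = Nat.card V + 1 := Finite.card_option
  have hE : H.edgeSet.ncard = G.edgeSet.ncard + 2 := by
    have h1 := Nat.card_congr Ψ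
    rw [Nat.card_sum, Nat.card_fin, card_dart_eq, card_dart_eq] at h1
    omega
  have hC : Nat.card H.ConnectedComponent ≤ Nat.card G.ConnectedComponent := by
    let f : G →g H := ⟨some, fun h => h⟩
    refine Nat.card_le_card_of_surjective (ConnectedComponent.map f) fun C => ?_
    induction C using ConnectedComponent.ind with
    | _ v =>
    cases v with
    | some v => exact ⟨G.connectedComponentMk v, rfl⟩
    | none => exact ⟨G.connectedComponentMk a, ConnectedComponent.sound ax.adj.reachable⟩
  have hI : {v | G.IsIsolated v}.ncard ≤ {v | H.IsIsolated v}.ncard := by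
    rw [← Set.ncard_image_of_injective {v | G.IsIsolated v} (Option.some_injective V)]
    refine Set.ncard_le_ncard ?_
    rintro _ ⟨v, hv, rfl⟩ (_ | w) hw
    · rcases (hw : v = a ∨ v = b) with rfl | rfl
      · exact hv _ hab
      · exact hv _ hab.symm
    · exact hv w hw
  have hF : R.facePerm.numCycles + 1 ≤ R'.facePerm.numCycles := by
    let g : G.Dart ⊕ Fin 4 → Option (Quotient (Equiv.Perm.SameCycle.setoid R.facePerm)) :=
      Sum.elim (fun d => if d = ab then none else some (Quotient.mk _ d))
        ![some (Quotient.mk _ ab), some (Quotient.mk _ ab), none, none]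
    have hg1 : ∀ y, g (Ψ.symm (ψ y)) = g y := fun y => congrArg g (Ψ.symm_apply_apply y)
    have hgι : ∀ d, d ≠ ab → g (Ψ.symm (ι d)) = some (Quotient.mk _ d) := fun d hd =>
      (hg1 (.inl d)).trans (by simp [g, hd])
    have hgab : g (Ψ.symm (ι ab)) = none := (hg1 (.inl ab)).trans (by simp [g])
    have hgax : g (Ψ.symm ax) = some (Quotient.mk _ ab) := hg1 (.inr 0)
    have hgxb : g (Ψ.symm xb) = some (Quotient.mk _ ab) := hg1 (.inr 1)
    have hgbx : g (Ψ.symm xb.symm) = none := hg1 (.inr 2)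
    have hgxa : g (Ψ.symm ax.symm) = none := hg1 (.inr 3)
    have hq : ∀ d, Quotient.mk (Equiv.Perm.SameCycle.setoid R.facePerm) (R.facePerm d) =
        Quotient.mk _ d := fun d =>
      Quotient.sound (Equiv.Perm.sameCycle_apply_left.2 (Equiv.Perm.SameCycle.refl _ d))
    have hinv : ∀ x, g (Ψ.symm (R'.facePerm x)) = g (Ψ.symm x) := by
      simp only [hR']
      refine hcases _ (fun d => ?_) (by rw [e3, hgax, hgxb]) ?_ (by rw [e6, hgxa, hgbx])
        (by rw [e7, hgxa, hgab])
      · by_cases h1 : d = ab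
        · rw [h1, e5, hgbx, hgab]
        by_cases h2 : R.facePerm d = ab
        · rw [e2 d h2, hgax, hgι d h1, ← h2, hq]
        · rw [e1 d h1 h2, hgι _ h2, hgι _ h1, hq]
      · rw [e4, hgι _ (R.facePerm_ne_self ab), hgxb, hq]
    rw [Equiv.Perm.numCycles, Equiv.Perm.numCycles, ← Finite.card_option]
    refine Nat.card_le_card_of_surjective (Quotient.lift (fun x => g (Ψ.symm x)) fun x y hxy =>
      Equiv.Perm.SameCycle.map_eq (fun x => g (Ψ.symm x)) hinv hxy) fun q => ?_
    rcases q with _ | q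
    · exact ⟨Quotient.mk _ (ι ab), hgab⟩
    · induction q using Quotient.inductionOn with
      | h d =>
      by_cases hd : d = ab
      · exact ⟨Quotient.mk _ ax, hgax.trans (by rw [hd])⟩
      · exact ⟨Quotient.mk _ (ι d), hgι d hd⟩
  have h1 := R.numFaces_eq
  have h2 := R'.numFaces_eq
  have h3 : Nat.card V + R.numFaces = G.edgeSet.ncard + 2 * Nat.card G.ConnectedComponent := hR
  omega

end SimpleGraph

namespace SimpleGraph

/-! ### Gluing along facial triangles -/

section Triangle

variable {V : Type u} {G : SimpleGraph V} {R : RotationSystem G} {a b c : V}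

/-- The dart `d` is one of the darts `a b`, `b c`, `c a`. -/
def OnTriangle (a b c : V) (d : G.Dart) : Prop :=
  (d.fst = a ∧ d.snd = b) ∨ (d.fst = b ∧ d.snd = c) ∨ (d.fst = c ∧ d.snd = a)

lemma RotationSystem.IsFace.onTriangle_facePerm_iff (h : R.IsFace a b c) (d : G.Dart) :
    OnTriangle a b c (R.facePerm d) ↔ OnTriangle a b c d := by
  obtain ⟨h1, h2, h3, e1, e2, e3⟩ := h
  constructor
  · have key : ∀ {e : G.Dart} {x y : V} (hxy : G.Adj x y), R.facePerm e = ⟨(x, y), hxy⟩ →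
        (R.facePerm d).fst = x → (R.facePerm d).snd = y → d = e := fun hxy he hx hy =>
      R.facePerm.injective ((Dart.ext _ _ (Prod.ext hx hy)).trans he.symm)
    rintro (⟨hx, hy⟩ | ⟨hx, hy⟩ | ⟨hx, hy⟩)
    · rw [key h1 e3 hx hy]; exact .inr (.inr ⟨rfl, rfl⟩)
    · rw [key h2 e1 hx hy]; exact .inl ⟨rfl, rfl⟩
    · rw [key h3 e2 hx hy]; exact .inr (.inl ⟨rfl, rfl⟩)
  · have key : ∀ {x y : V} (hxy : G.Adj x y), d.fst = x → d.snd = y → d = ⟨(x, y), hxy⟩ :=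
      fun hxy hx hy => Dart.ext _ _ (Prod.ext hx hy)
    rintro (⟨hx, hy⟩ | ⟨hx, hy⟩ | ⟨hx, hy⟩)
    · rw [key h1 hx hy, e1]; exact .inr (.inl ⟨rfl, rfl⟩)
    · rw [key h2 hx hy, e2]; exact .inr (.inr ⟨rfl, rfl⟩)
    · rw [key h3 hx hy, e3]; exact .inl ⟨rfl, rfl⟩

lemma RotationSystem.IsFace.sameCycle (h : R.IsFace a b c) {d e : G.Dart}
    (hd : OnTriangle a b c d) (he : OnTriangle a b c e) : R.facePerm.SameCycle d e := by
  obtain ⟨h1, h2, h3, e1, e2, e3⟩ := h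
  have key : ∀ d : G.Dart, OnTriangle a b c d → R.facePerm.SameCycle ⟨(a, b), h1⟩ d := by
    have k1 : R.facePerm.SameCycle ⟨(a, b), h1⟩ ⟨(b, c), h2⟩ := ⟨1, by simpa using e1⟩
    have k2 : R.facePerm.SameCycle ⟨(b, c), h2⟩ ⟨(c, a), h3⟩ := ⟨1, by simpa using e2⟩
    rintro ⟨⟨x, y⟩, hxy⟩ (⟨rfl, rfl⟩ | ⟨rfl, rfl⟩ | ⟨rfl, rfl⟩)
    exacts [.refl _ _, k1, k1.trans k2]
  exact (key d hd).symm.trans (key e he)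

lemma RotationSystem.IsFace.card_dart [Finite V] (h : R.IsFace a b c) :
    Nat.card {d : G.Dart // ¬ OnTriangle a b c d} + 3 = Nat.card G.Dart := by
  obtain ⟨h1, h2, h3, -⟩ := h
  have hset : {d : G.Dart | OnTriangle a b c d} =
      {⟨(a, b), h1⟩, ⟨(b, c), h2⟩, ⟨(c, a), h3⟩} := by
    ext d
    simp [OnTriangle, Dart.ext_iff, Prod.ext_iff]
  have h3 : {d : G.Dart | OnTriangle a b c d}.ncard = 3 := by
    rw [hset]
    exact Set.ncard_eq_three.2 ⟨_, _, _, by simp [h1.ne], by simp [h3.ne'], by simp [h2.ne], rfl⟩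
  have h4 := Set.ncard_add_ncard_compl {d : G.Dart | OnTriangle a b c d}
  rw [h3] at h4
  rw [← h4, add_comm]
  rfl

/-- If the darts of `G` away from a facial triangle keep their successors in the face tracing
permutation `φ` of a larger graph, then all darts of `G` with the same tail belong to the same
cycle around this vertex in the larger graph.  Indeed, at each corner of the triangle only one
step of the rotation is lost. -/
lemma RotationSystem.IsFace.sameCycle_map [Finite V] (hF : R.IsFace a b c) {W : Type u}
    {H : SimpleGraph W} (φ : Equiv.Perm H.Dart) (e : G.Dart → H.Dart)
    (he : ∀ d, e d.symm = (e d).symm)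
    (hφ : ∀ d, ¬ OnTriangle a b c d → φ (e d) = e (R.facePerm d)) {d d' : G.Dart}
    (h : d.fst = d'.fst) : (φ * H.flipPerm).SameCycle (e d) (e d') := by
  obtain ⟨h1, h2, h3, -⟩ := id hF
  let r : G.Dart → G.Dart → Prop := fun d d' => (φ * H.flipPerm).SameCycle (e d) (e d')
  have hr : Equivalence r := (Equiv.Perm.SameCycle.equivalence _).comap e
  have hstep : ∀ d : G.Dart, ¬ OnTriangle a b c d.symm → r d (R.next d) := by
    intro d hd
    have h := Equiv.Perm.sameCycle_apply_right.2
      (Equiv.Perm.SameCycle.refl (φ * H.flipPerm) (e d))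
    rwa [Equiv.Perm.mul_apply, flipPerm_apply, ← he, hφ _ hd, ← R.next_eq_facePerm] at h
  refine Equiv.Perm.SameCycle.rel hr (fun q => ?_) ((R.sameCycle_iff d d').2 h)
  by_cases hq : OnTriangle a b c q.symm
  · refine hr.symm (Equiv.Perm.SameCycle.rel_of_avoid hr (fun x hx hxq => hstep x fun hx' => ?_)
      (Equiv.Perm.sameCycle_apply_left.2 (Equiv.Perm.SameCycle.refl _ q)))
    rw [R.sameCycle_iff] at hx
    obtain ⟨⟨x1, x2⟩, hx0⟩ := x
    obtain ⟨⟨q1, q2⟩, hq0⟩ := q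
    have n1 := h1.ne
    have n2 := h2.ne
    have n3 := h3.ne
    simp only [OnTriangle, Dart.symm_mk, Prod.swap_prod_mk, Dart.ext_iff, Prod.mk.injEq, ne_eq]
      at hx hq hx' hxq
    grind
  · exact hstep q hq

end Triangle

open RotationSystem

variable {V₁ V₂ W : Type u} [Finite V₁] [Finite V₂] [Finite W]
  {G₁ : SimpleGraph V₁} {G₂ : SimpleGraph V₂} {H : SimpleGraph W}

/-- If two graphs drawn in the sphere have a facial triangle, traced in opposite directions, then
the graph `H` which arises from identifying these two triangles can be drawn in the sphere
such that its faces are the remaining faces of the two drawings. -/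
theorem exists_isSpherical_of_glue {R₁ : RotationSystem G₁} {R₂ : RotationSystem G₂}
    (hR₁ : R₁.IsSpherical) (hR₂ : R₂.IsSpherical) {a b c : V₁} {a' b' c' : V₂}
    (hF₁ : R₁.IsFace a b c) (hF₂ : R₂.IsFace b' a' c') (f₁ : V₁ → W) (f₂ : V₂ → W)
    (hf₁ : Function.Injective f₁) (hf₂ : Function.Injective f₂)
    (hf : ∀ x y, f₁ x = f₂ y ↔ (x = a ∧ y = a') ∨ (x = b ∧ y = b') ∨ (x = c ∧ y = c'))
    (hcov : ∀ w, (∃ x, f₁ x = w) ∨ ∃ y, f₂ y = w)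
    (hcard : Nat.card V₁ + Nat.card V₂ = Nat.card W + 3)
    (hH : ∀ w w', H.Adj w w' ↔ (∃ x y, G₁.Adj x y ∧ f₁ x = w ∧ f₁ y = w') ∨
      ∃ x y, G₂.Adj x y ∧ f₂ x = w ∧ f₂ y = w') :
    ∃ R : RotationSystem H, R.IsSpherical ∧ ∀ x y z, R₁.IsFace x y z →
      ¬ ((x = a ∧ y = b) ∨ (x = b ∧ y = c) ∨ (x = c ∧ y = a)) →
      R.IsFace (f₁ x) (f₁ y) (f₁ z) := by
  classical
  obtain ⟨hab, hbc, hca, -⟩ := id hF₁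
  obtain ⟨hba', hac', hcb', -⟩ := id hF₂
  let e₁ : G₁.Dart → H.Dart := fun d => ⟨(f₁ d.fst, f₁ d.snd),
    (hH _ _).2 (.inl ⟨_, _, d.adj, rfl, rfl⟩)⟩
  let e₂ : G₂.Dart → H.Dart := fun d => ⟨(f₂ d.fst, f₂ d.snd),
    (hH _ _).2 (.inr ⟨_, _, d.adj, rfl, rfl⟩)⟩
  have he₁ : Function.Injective e₁ := fun d d' h => by
    have h' : (e₁ d).toProd = (e₁ d').toProd := congrArg _ h
    simp only [e₁, Prod.mk.injEq] at h'
    exact Dart.ext _ _ (Prod.ext (hf₁ h'.1) (hf₁ h'.2))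
  have he₂ : Function.Injective e₂ := fun d d' h => by
    have h' : (e₂ d).toProd = (e₂ d').toProd := congrArg _ h
    simp only [e₂, Prod.mk.injEq] at h'
    exact Dart.ext _ _ (Prod.ext (hf₂ h'.1) (hf₂ h'.2))
  have he₁₂ : ∀ d d', e₁ d = e₂ d' ↔ f₁ d.fst = f₂ d'.fst ∧ f₁ d.snd = f₂ d'.snd := by
    intro d d'
    simp [e₁, e₂, Dart.ext_iff]
  have ha : f₁ a = f₂ a' := (hf _ _).2 (.inl ⟨rfl, rfl⟩)
  have hb : f₁ b = f₂ b' := (hf _ _).2 (.inr (.inl ⟨rfl, rfl⟩))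
  have hc : f₁ c = f₂ c' := (hf _ _).2 (.inr (.inr ⟨rfl, rfl⟩))
  have n1 := hab.ne
  have n2 := hbc.ne
  have n3 := hca.ne
  have n1' := hba'.ne
  have n2' := hac'.ne
  have n3' := hcb'.ne
  let ψ : {d : G₁.Dart // ¬ OnTriangle a b c d} ⊕ {d : G₂.Dart // ¬ OnTriangle b' a' c' d} →
      H.Dart := Sum.elim (fun d => e₁ d) (fun d => e₂ d)
  have hdisj : ∀ (d : G₁.Dart) (d' : G₂.Dart), ¬ OnTriangle a b c d → ¬ OnTriangle b' a' c' d' →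
      e₁ d ≠ e₂ d' := by
    intro d d' hd hd' h
    rw [he₁₂, hf, hf] at h
    have := d.adj.ne
    unfold OnTriangle at hd hd'
    grind
  have hcases : ∀ x : H.Dart, (∃ d, ¬ OnTriangle a b c d ∧ e₁ d = x) ∨
      ∃ d, ¬ OnTriangle b' a' c' d ∧ e₂ d = x := by
    rintro ⟨⟨w, w'⟩, hw⟩
    rcases (hH _ _).1 hw with ⟨x, y, hxy, rfl, rfl⟩ | ⟨x, y, hxy, rfl, rfl⟩
    · by_cases h : (x = a ∧ y = b) ∨ (x = b ∧ y = c) ∨ (x = c ∧ y = a)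
      · refine .inr ?_
        rcases h with ⟨rfl, rfl⟩ | ⟨rfl, rfl⟩ | ⟨rfl, rfl⟩
        · exact ⟨⟨(a', b'), hba'.symm⟩, by simp only [OnTriangle]; grind,
            Dart.ext _ _ (Prod.ext ha.symm hb.symm)⟩
        · exact ⟨⟨(b', c'), hcb'.symm⟩, by simp only [OnTriangle]; grind,
            Dart.ext _ _ (Prod.ext hb.symm hc.symm)⟩
        · exact ⟨⟨(c', a'), hac'.symm⟩, by simp only [OnTriangle]; grind,
            Dart.ext _ _ (Prod.ext hc.symm ha.symm)⟩
      · exact .inl ⟨⟨(x, y), hxy⟩, h, rfl⟩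
    · by_cases h : (x = b' ∧ y = a') ∨ (x = a' ∧ y = c') ∨ (x = c' ∧ y = b')
      · refine .inl ?_
        rcases h with ⟨rfl, rfl⟩ | ⟨rfl, rfl⟩ | ⟨rfl, rfl⟩
        · exact ⟨⟨(b, a), hab.symm⟩, by simp only [OnTriangle]; grind,
            Dart.ext _ _ (Prod.ext hb ha)⟩
        · exact ⟨⟨(a, c), hca.symm⟩, by simp only [OnTriangle]; grind,
            Dart.ext _ _ (Prod.ext ha hc)⟩
        · exact ⟨⟨(c, b), hbc.symm⟩, by simp only [OnTriangle]; grind,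
            Dart.ext _ _ (Prod.ext hc hb)⟩
      · exact .inr ⟨⟨(x, y), hxy⟩, h, rfl⟩
  have hψ : Function.Bijective ψ := by
    constructor
    · refine Function.Injective.sumElim (he₁.comp Subtype.val_injective)
        (he₂.comp Subtype.val_injective) fun d d' => hdisj d d' d.2 d'.2
    · intro x
      rcases hcases x with ⟨d, hd, h⟩ | ⟨d, hd, h⟩
      · exact ⟨.inl ⟨d, hd⟩, h⟩
      · exact ⟨.inr ⟨d, hd⟩, h⟩
  let Ψ := Equiv.ofBijective ψ hψ
  have hΨ : ∀ y, Ψ.symm (ψ y) = y := Ψ.symm_apply_apply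
  obtain ⟨φ, hφ₁, hφ₂⟩ : ∃ φ : Equiv.Perm H.Dart,
      (∀ d, ¬ OnTriangle a b c d → φ (e₁ d) = e₁ (R₁.facePerm d)) ∧
      ∀ d, ¬ OnTriangle b' a' c' d → φ (e₂ d) = e₂ (R₂.facePerm d) := by
    let ρ := Equiv.Perm.sumCongr
      (R₁.facePerm.subtypePerm (p := fun d => ¬ OnTriangle a b c d) fun d =>
        not_congr (hF₁.onTriangle_facePerm_iff d))
      (R₂.facePerm.subtypePerm (p := fun d => ¬ OnTriangle b' a' c' d) fun d =>
        not_congr (hF₂.onTriangle_facePerm_iff d))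
    have hφ : ∀ y, (Ψ.permCongr ρ) (ψ y) = ψ (ρ y) := fun y => by
      rw [Equiv.permCongr_apply]
      exact congrArg (fun z => ψ (ρ z)) (hΨ y)
    exact ⟨Ψ.permCongr ρ, fun d hd => hφ (.inl ⟨d, hd⟩), fun d hd => hφ (.inr ⟨d, hd⟩)⟩
  have hφfst : ∀ x, (φ x).fst = x.snd := by
    intro x
    rcases hcases x with ⟨d, hd, rfl⟩ | ⟨d, hd, rfl⟩
    · rw [hφ₁ d hd]; exact congrArg f₁ (R₁.fst_facePerm d)
    · rw [hφ₂ d hd]; exact congrArg f₂ (R₂.fst_facePerm d)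
  have hsame : ∀ x y : H.Dart, x.fst = y.fst → (φ * H.flipPerm).SameCycle x y := by
    have h1 : ∀ d d' : G₁.Dart, d.fst = d'.fst → (φ * H.flipPerm).SameCycle (e₁ d) (e₁ d') :=
      fun d d' h => hF₁.sameCycle_map φ e₁ (fun _ => rfl) hφ₁ h
    have h2 : ∀ d d' : G₂.Dart, d.fst = d'.fst → (φ * H.flipPerm).SameCycle (e₂ d) (e₂ d') :=
      fun d d' h => hF₂.sameCycle_map φ e₂ (fun _ => rfl) hφ₂ h
    have h3 : ∀ (d : G₁.Dart) (d' : G₂.Dart), f₁ d.fst = f₂ d'.fst →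
        (φ * H.flipPerm).SameCycle (e₁ d) (e₂ d') := by
      intro d d' h
      -- the two rotations share a dart along the triangle
      obtain ⟨k, k', hk, hk', hkk⟩ : ∃ (k : G₁.Dart) (k' : G₂.Dart), d.fst = k.fst ∧
          k'.fst = d'.fst ∧ e₁ k = e₂ k' := by
        rcases (hf _ _).1 h with ⟨hx, hy⟩ | ⟨hx, hy⟩ | ⟨hx, hy⟩
        · exact ⟨⟨(a, b), hab⟩, ⟨(a', b'), hba'.symm⟩, hx, hy.symm,
            (he₁₂ _ _).2 ⟨ha, hb⟩⟩
        · exact ⟨⟨(b, c), hbc⟩, ⟨(b', c'), hcb'.symm⟩, hx, hy.symm,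
            (he₁₂ _ _).2 ⟨hb, hc⟩⟩
        · exact ⟨⟨(c, a), hca⟩, ⟨(c', a'), hac'.symm⟩, hx, hy.symm,
            (he₁₂ _ _).2 ⟨hc, ha⟩⟩
      have := h2 k' d' hk'
      rw [← hkk] at this
      exact (h1 d k hk).trans this
    intro x y hxy
    rcases hcases x with ⟨d, hd, rfl⟩ | ⟨d, hd, rfl⟩ <;>
      rcases hcases y with ⟨d', hd', rfl⟩ | ⟨d', hd', rfl⟩
    · exact h1 d d' (hf₁ hxy)
    · exact h3 d d' hxy
    · exact (h3 d' d hxy.symm).symm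
    · exact h2 d d' (hf₂ hxy)
  let R := RotationSystem.ofFacePerm φ hφfst hsame
  have hR : ∀ x, R.facePerm x = φ x := RotationSystem.facePerm_ofFacePerm φ hφfst hsame
  refine ⟨R, R.isSpherical_of_le ?_, ?_⟩
  · have hE : H.edgeSet.ncard + 3 = G₁.edgeSet.ncard + G₂.edgeSet.ncard := by
      have h1 := Nat.card_congr Ψ
      have h2 := hF₁.card_dart
      have h3 := hF₂.card_dart
      rw [Nat.card_sum, card_dart_eq] at h1
      rw [card_dart_eq] at h2 h3
      omega
    have hC : Nat.card H.ConnectedComponent + 1 ≤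
        Nat.card G₁.ConnectedComponent + Nat.card G₂.ConnectedComponent := by
      let g₁ : G₁ →g H := ⟨f₁, fun h => (hH _ _).2 (.inl ⟨_, _, h, rfl, rfl⟩)⟩
      let g₂ : G₂ →g H := ⟨f₂, fun h => (hH _ _).2 (.inr ⟨_, _, h, rfl, rfl⟩)⟩
      let g : G₁.ConnectedComponent ⊕ G₂.ConnectedComponent → H.ConnectedComponent :=
        Sum.elim (ConnectedComponent.map g₁) (ConnectedComponent.map g₂)
      have hg : Function.Surjective g := by
        intro C
        induction C using ConnectedComponent.ind with
        | _ w =>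
        rcases hcov w with ⟨x, rfl⟩ | ⟨y, rfl⟩
        · exact ⟨.inl (G₁.connectedComponentMk x), rfl⟩
        · exact ⟨.inr (G₂.connectedComponentMk y), rfl⟩
      have hnot : ¬ Function.Injective g := by
        intro hinj
        have h : g (.inl (G₁.connectedComponentMk a)) = g (.inr (G₂.connectedComponentMk a')) :=
          congrArg H.connectedComponentMk ha
        exact Sum.inl_ne_inr (hinj h)
      rw [← Nat.card_sum, Nat.add_one_le_iff]
      refine lt_of_le_of_ne (Nat.card_le_card_of_surjective g hg) fun h => hnot ?_
      exact (hg.bijective_of_nat_card_le h.ge).1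
    have hI : {v | G₁.IsIsolated v}.ncard + {v | G₂.IsIsolated v}.ncard ≤
        {v | H.IsIsolated v}.ncard := by
      have hiso : ∀ x y, f₁ x = f₂ y → ¬ G₁.IsIsolated x ∧ ¬ G₂.IsIsolated y := by
        intro x y hxy
        rcases (hf _ _).1 hxy with ⟨rfl, rfl⟩ | ⟨rfl, rfl⟩ | ⟨rfl, rfl⟩
        · exact ⟨fun h => h _ hab, fun h => h _ hac'⟩
        · exact ⟨fun h => h _ hbc, fun h => h _ hba'⟩
        · exact ⟨fun h => h _ hca, fun h => h _ hcb'⟩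
      rw [← Nat.card_coe_set_eq, ← Nat.card_coe_set_eq, ← Nat.card_coe_set_eq, ← Nat.card_sum]
      refine Nat.card_le_card_of_injective (Sum.elim
        (fun v => ⟨f₁ v.1, fun w hw => ?_⟩) (fun v => ⟨f₂ v.1, fun w hw => ?_⟩)) ?_
      · rcases (hH _ _).1 hw with ⟨x, y, hxy, hx, -⟩ | ⟨x, y, hxy, hx, -⟩
        · exact v.2 y (hf₁ hx ▸ hxy)
        · exact (hiso _ _ hx.symm).1 v.2
      · rcases (hH _ _).1 hw with ⟨x, y, hxy, hx, -⟩ | ⟨x, y, hxy, hx, -⟩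
        · exact (hiso _ _ hx).2 v.2
        · exact v.2 y (hf₂ hx ▸ hxy)
      · refine Function.Injective.sumElim (fun v v' h => ?_) (fun v v' h => ?_) fun v v' h => ?_
        · exact Subtype.ext (hf₁ (congrArg Subtype.val h))
        · exact Subtype.ext (hf₂ (congrArg Subtype.val h))
        · exact (hiso _ _ (congrArg Subtype.val h)).1 v.2
    -- all faces but the two which are glued together survive
    have hF : R₁.facePerm.numCycles + R₂.facePerm.numCycles ≤ R.facePerm.numCycles + 2 := by
      let g : H.Dart → Quotient (Equiv.Perm.SameCycle.setoid R₁.facePerm) ⊕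
          Quotient (Equiv.Perm.SameCycle.setoid R₂.facePerm) := fun x =>
        Sum.map (fun d => Quotient.mk _ d.1) (fun d => Quotient.mk _ d.1) (Ψ.symm x)
      have hg₁ : ∀ d, ¬ OnTriangle a b c d → g (e₁ d) = .inl (Quotient.mk _ d) := fun d hd =>
        congrArg (Sum.map _ _) (hΨ (.inl ⟨d, hd⟩))
      have hg₂ : ∀ d, ¬ OnTriangle b' a' c' d → g (e₂ d) = .inr (Quotient.mk _ d) := fun d hd =>
        congrArg (Sum.map _ _) (hΨ (.inr ⟨d, hd⟩))
      have hinv : ∀ x, g (R.facePerm x) = g x := by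
        intro x
        rw [hR]
        rcases hcases x with ⟨d, hd, rfl⟩ | ⟨d, hd, rfl⟩
        · rw [hφ₁ d hd, hg₁ _ (mt (hF₁.onTriangle_facePerm_iff d).1 hd), hg₁ d hd]
          exact congrArg Sum.inl (Quotient.sound
            (Equiv.Perm.sameCycle_apply_left.2 (Equiv.Perm.SameCycle.refl _ d)))
        · rw [hφ₂ d hd, hg₂ _ (mt (hF₂.onTriangle_facePerm_iff d).1 hd), hg₂ d hd]
          exact congrArg Sum.inr (Quotient.sound
            (Equiv.Perm.sameCycle_apply_left.2 (Equiv.Perm.SameCycle.refl _ d)))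
      have h2 : (2 : ℕ) = Nat.card (Unit ⊕ Unit) := by simp
      rw [Equiv.Perm.numCycles, Equiv.Perm.numCycles, Equiv.Perm.numCycles, h2, ← Nat.card_sum,
        ← Nat.card_sum]
      refine Nat.card_le_card_of_surjective (Sum.elim
        (Quotient.lift g fun x y hxy => Equiv.Perm.SameCycle.map_eq g hinv hxy)
        (Sum.map (fun _ => Quotient.mk _ ⟨(a, b), hab⟩)
          (fun _ => Quotient.mk _ ⟨(b', a'), hba'⟩))) ?_
      rintro (q | q) <;> induction q using Quotient.inductionOn with
      | h d => ?_
      · by_cases hd : OnTriangle a b c d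
        · exact ⟨.inr (.inl ()), congrArg Sum.inl (Quotient.sound
            (hF₁.sameCycle (.inl ⟨rfl, rfl⟩) hd))⟩
        · exact ⟨.inl (Quotient.mk _ (e₁ d)), hg₁ d hd⟩
      · by_cases hd : OnTriangle b' a' c' d
        · exact ⟨.inr (.inr ()), congrArg Sum.inr (Quotient.sound
            (hF₂.sameCycle (.inl ⟨rfl, rfl⟩) hd))⟩
        · exact ⟨.inl (Quotient.mk _ (e₂ d)), hg₂ d hd⟩
    have h1 := R₁.numFaces_eq
    have h2 := R₂.numFaces_eq
    have h3 := R.numFaces_eq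
    have h4 : Nat.card V₁ + R₁.numFaces =
      G₁.edgeSet.ncard + 2 * Nat.card G₁.ConnectedComponent := hR₁
    have h5 : Nat.card V₂ + R₂.numFaces =
      G₂.edgeSet.ncard + 2 * Nat.card G₂.ConnectedComponent := hR₂
    omega
  · rintro x y z ⟨hxy, hyz, hzx, h1, h2, h3⟩ hn
    have k1 : ¬ OnTriangle a b c (⟨(x, y), hxy⟩ : G₁.Dart) := hn
    have k2 : ¬ OnTriangle a b c (⟨(y, z), hyz⟩ : G₁.Dart) := by
      rw [← h1, hF₁.onTriangle_facePerm_iff]; exact k1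
    have k3 : ¬ OnTriangle a b c (⟨(z, x), hzx⟩ : G₁.Dart) := by
      rw [← h2, hF₁.onTriangle_facePerm_iff]; exact k2
    refine ⟨(e₁ ⟨(x, y), hxy⟩).adj, (e₁ ⟨(y, z), hyz⟩).adj, (e₁ ⟨(z, x), hzx⟩).adj, ?_, ?_, ?_⟩
    · exact (hR _).trans ((hφ₁ _ k1).trans (congrArg e₁ h1))
    · exact (hR _).trans ((hφ₁ _ k2).trans (congrArg e₁ h2))
    · exact (hR _).trans ((hφ₁ _ k3).trans (congrArg e₁ h3))

end SimpleGraph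

open SimpleGraph

lemma Digraph.IsOrientationOf.adj_iff_not {V : Type u} {D : Digraph V} {G : SimpleGraph V}
    (h : D.IsOrientationOf G) {x y : V} (hxy : G.Adj x y) : D.Adj x y ↔ ¬ D.Adj y x :=
  ⟨h.asymm x y, fun hn => ((h.adj_iff x y).1 hxy).resolve_right hn⟩

/-- An orientation of a graph which is drawn in the sphere. -/
structure PlaneDigraph (V : Type u) where
  /-- the underlying graph -/
  graph : SimpleGraph V
  /-- the drawing -/
  rot : RotationSystem graph
  /-- the orientation -/
  digraph : Digraph V
  isSpherical : rot.IsSpherical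
  isOrientationOf : digraph.IsOrientationOf graph

namespace PlaneDigraph

/-- Gluing of oriented graphs along a facial triangle. -/
theorem exists_glue {V₁ V₂ : Type u} [Finite V₁] [Finite V₂] (P₁ : PlaneDigraph V₁)
    (P₂ : PlaneDigraph V₂) {a b c : V₁} {a' b' c' : V₂} (hF₁ : P₁.rot.IsFace a b c)
    (hF₂ : P₂.rot.IsFace b' a' c') (hab : P₁.digraph.Adj a b ↔ P₂.digraph.Adj a' b')
    (hbc : P₁.digraph.Adj b c ↔ P₂.digraph.Adj b' c')
    (hca : P₁.digraph.Adj c a ↔ P₂.digraph.Adj c' a') :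
    ∃ (W : Type u) (_ : Finite W) (P : PlaneDigraph W) (f₁ : V₁ → W) (f₂ : V₂ → W),
      Function.Injective f₁ ∧ (∀ x y, P₁.digraph.Adj x y → P.digraph.Adj (f₁ x) (f₁ y)) ∧
      (∀ x y, P₂.digraph.Adj x y → P.digraph.Adj (f₂ x) (f₂ y)) ∧
      f₁ a = f₂ a' ∧ f₁ b = f₂ b' ∧ f₁ c = f₂ c' ∧
      ∀ x y z, P₁.rot.IsFace x y z → ¬ ((x = a ∧ y = b) ∨ (x = b ∧ y = c) ∨ (x = c ∧ y = a)) →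
        P.rot.IsFace (f₁ x) (f₁ y) (f₁ z) := by
  classical
  have := Fintype.ofFinite V₁
  have := Fintype.ofFinite V₂
  obtain ⟨gab, gbc, gca, -⟩ := id hF₁
  obtain ⟨gba', gac', gcb', -⟩ := id hF₂
  have n1 := gab.ne
  have n2 := gbc.ne
  have n3 := gca.ne
  have n1' := gba'.ne
  have n2' := gac'.ne
  have n3' := gcb'.ne
  let W := V₁ ⊕ {v : V₂ // v ∉ ({a', b', c'} : Finset V₂)}
  let f₁ : V₁ → W := Sum.inl
  let f₂ : V₂ → W := fun v => if h : v ∉ ({a', b', c'} : Finset V₂) then Sum.inr ⟨v, h⟩ else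
    Sum.inl (if v = a' then a else if v = b' then b else c)
  have hf₁ : Function.Injective f₁ := Sum.inl_injective
  have ha : f₂ a' = f₁ a := by simp [f₂, f₁]
  have hb : f₂ b' = f₁ b := by simp [f₂, f₁, n1']
  have hc : f₂ c' = f₁ c := by simp [f₂, f₁, n2'.symm, n3']
  have ho : ∀ v (h : v ∉ ({a', b', c'} : Finset V₂)), f₂ v = Sum.inr ⟨v, h⟩ := fun v h => by
    simp only [f₂, dif_pos h]
  have hcases : ∀ v, v = a' ∨ v = b' ∨ v = c' ∨ v ∉ ({a', b', c'} : Finset V₂) := fun v => by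
    simp only [Finset.mem_insert, Finset.mem_singleton]
    tauto
  have hf₂ : Function.Injective f₂ := by
    intro u v h
    rcases hcases u with rfl | rfl | rfl | hu <;> rcases hcases v with rfl | rfl | rfl | hv <;>
      first
      | rfl
      | exact absurd (hf₁ (ha.symm.trans (h.trans hb))) n1
      | exact absurd (hf₁ (hb.symm.trans (h.trans ha))) n1.symm
      | exact absurd (hf₁ (hb.symm.trans (h.trans hc))) n2
      | exact absurd (hf₁ (hc.symm.trans (h.trans hb))) n2.symm
      | exact absurd (hf₁ (hc.symm.trans (h.trans ha))) n3
      | exact absurd (hf₁ (ha.symm.trans (h.trans hc))) n3.symm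
      | exact absurd (ha.symm.trans (h.trans (ho _ hv))) Sum.inl_ne_inr
      | exact absurd (hb.symm.trans (h.trans (ho _ hv))) Sum.inl_ne_inr
      | exact absurd (hc.symm.trans (h.trans (ho _ hv))) Sum.inl_ne_inr
      | exact absurd ((ho _ hu).symm.trans (h.trans ha)) Sum.inr_ne_inl
      | exact absurd ((ho _ hu).symm.trans (h.trans hb)) Sum.inr_ne_inl
      | exact absurd ((ho _ hu).symm.trans (h.trans hc)) Sum.inr_ne_inl
      | exact congrArg Subtype.val (Sum.inr_injective ((ho _ hu).symm.trans (h.trans (ho _ hv))))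
  have hf : ∀ x y, f₁ x = f₂ y ↔ (x = a ∧ y = a') ∨ (x = b ∧ y = b') ∨ (x = c ∧ y = c') := by
    intro x y
    constructor
    · intro h
      rcases hcases y with rfl | rfl | rfl | hy
      · exact .inl ⟨hf₁ (h.trans ha), rfl⟩
      · exact .inr (.inl ⟨hf₁ (h.trans hb), rfl⟩)
      · exact .inr (.inr ⟨hf₁ (h.trans hc), rfl⟩)
      · rw [ho y hy] at h
        exact absurd h Sum.inl_ne_inr
    · rintro (⟨rfl, rfl⟩ | ⟨rfl, rfl⟩ | ⟨rfl, rfl⟩)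
      exacts [ha.symm, hb.symm, hc.symm]
  have hcov : ∀ w, (∃ x, f₁ x = w) ∨ ∃ y, f₂ y = w := by
    rintro (x | ⟨y, hy⟩)
    · exact .inl ⟨x, rfl⟩
    · exact .inr ⟨y, ho y hy⟩
  have hcard : Nat.card V₁ + Nat.card V₂ = Nat.card W + 3 := by
    have h1 : ({a', b', c'} : Finset V₂).card = 3 :=
      Finset.card_eq_three.2 ⟨_, _, _, n1'.symm, n2', n3'.symm, rfl⟩
    have h2 : Nat.card W = Nat.card V₁ + Nat.card {v : V₂ // v ∉ ({a', b', c'} : Finset V₂)} :=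
      Nat.card_sum
    have h3 : Nat.card {v : V₂ // v ∉ ({a', b', c'} : Finset V₂)} = Fintype.card V₂ - 3 := by
      rw [Nat.card_eq_fintype_card, Fintype.card_subtype_compl, Fintype.card_coe, h1]
    have h4 := Finset.card_le_univ ({a', b', c'} : Finset V₂)
    rw [h2, h3, Nat.card_eq_fintype_card (α := V₂)]
    omega
  let D : Digraph W := ⟨fun w w' => (∃ x y, P₁.digraph.Adj x y ∧ f₁ x = w ∧ f₁ y = w') ∨
    ∃ x y, P₂.digraph.Adj x y ∧ f₂ x = w ∧ f₂ y = w'⟩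
  have hD₁ : ∀ x y, P₁.digraph.Adj x y → D.Adj (f₁ x) (f₁ y) := fun x y h => .inl ⟨x, y, h, rfl, rfl⟩
  have hD₂ : ∀ x y, P₂.digraph.Adj x y → D.Adj (f₂ x) (f₂ y) := fun x y h => .inr ⟨x, y, h, rfl, rfl⟩
  have hcompat : ∀ x y x' y', f₁ x = f₂ x' → f₁ y = f₂ y' → P₁.digraph.Adj x y →
      P₂.digraph.Adj y' x' → False := by
    intro x y x' y' hx hy h h'
    have hl₁ := P₁.isOrientationOf.asymm x y h
    have hl₂ := P₂.isOrientationOf.asymm y' x' h'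
    rcases (hf _ _).1 hx with ⟨rfl, rfl⟩ | ⟨rfl, rfl⟩ | ⟨rfl, rfl⟩ <;>
      rcases (hf _ _).1 hy with ⟨rfl, rfl⟩ | ⟨rfl, rfl⟩ | ⟨rfl, rfl⟩ <;>
      first
      | exact hl₁ h
      | exact hl₂ (hab.1 h)
      | exact hl₂ (hbc.1 h)
      | exact hl₂ (hca.1 h)
      | exact hl₁ (hab.2 h')
      | exact hl₁ (hbc.2 h')
      | exact hl₁ (hca.2 h')
  have hasymm : ∀ w w', D.Adj w w' → ¬ D.Adj w' w := by
    rintro w w' (⟨x, y, hxy, rfl, rfl⟩ | ⟨x, y, hxy, rfl, rfl⟩)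
      (⟨u, v, huv, hu, hv⟩ | ⟨u, v, huv, hu, hv⟩)
    · rw [hf₁ hu, hf₁ hv] at huv
      exact P₁.isOrientationOf.asymm _ _ hxy huv
    · exact hcompat _ _ _ _ hv.symm hu.symm hxy huv
    · exact hcompat _ _ _ _ hu hv huv hxy
    · rw [hf₂ hu, hf₂ hv] at huv
      exact P₂.isOrientationOf.asymm _ _ hxy huv
  let H : SimpleGraph W :=
    { Adj := fun w w' => D.Adj w w' ∨ D.Adj w' w
      symm := ⟨fun w w' h => h.symm⟩
      loopless := ⟨fun w h => hasymm w w (or_self_iff.1 h) (or_self_iff.1 h)⟩ }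
  have hH : ∀ w w', H.Adj w w' ↔ (∃ x y, P₁.graph.Adj x y ∧ f₁ x = w ∧ f₁ y = w') ∨
      ∃ x y, P₂.graph.Adj x y ∧ f₂ x = w ∧ f₂ y = w' := by
    intro w w'
    simp only [P₁.isOrientationOf.adj_iff, P₂.isOrientationOf.adj_iff]
    constructor
    · rintro ((⟨x, y, h, hx, hy⟩ | ⟨x, y, h, hx, hy⟩) | (⟨x, y, h, hx, hy⟩ | ⟨x, y, h, hx, hy⟩))
      · exact .inl ⟨x, y, .inl h, hx, hy⟩
      · exact .inr ⟨x, y, .inl h, hx, hy⟩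
      · exact .inl ⟨y, x, .inr h, hy, hx⟩
      · exact .inr ⟨y, x, .inr h, hy, hx⟩
    · rintro (⟨x, y, h | h, rfl, rfl⟩ | ⟨x, y, h | h, rfl, rfl⟩)
      · exact .inl (hD₁ _ _ h)
      · exact .inr (hD₁ _ _ h)
      · exact .inl (hD₂ _ _ h)
      · exact .inr (hD₂ _ _ h)
  obtain ⟨R, hR, hRF⟩ := exists_isSpherical_of_glue P₁.isSpherical P₂.isSpherical hF₁ hF₂ f₁ f₂
    hf₁ hf₂ hf hcov hcard hH
  exact ⟨W, inferInstance, ⟨H, R, D, hR, ⟨fun _ _ => Iff.rfl, hasymm⟩⟩, f₁, f₂, hf₁, hD₁, hD₂,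
    ha.symm, hb.symm, hc.symm, hRF⟩

end PlaneDigraph

/-! ### The octahedron -/

/-- The third vertex of the face of the octahedron on the left of the dart from `u` to `v`.  The
octahedron is drawn with an outer triangle `0 1 2`, an inner triangle `3 4 5`, and `3`, `4`, `5` next
to the edges `0 1`, `1 2`, `2 0`.  The value `u` means that `u` and `v` are not adjacent. -/
def octThird : Fin 6 → Fin 6 → Fin 6 :=
  ![![0, 3, 1, 5, 0, 2], ![2, 1, 4, 0, 3, 1], ![5, 0, 2, 2, 1, 4], ![1, 4, 3, 3, 5, 0],
    ![4, 2, 5, 1, 4, 3], ![3, 5, 0, 4, 2, 5]]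

/-- The graph of the octahedron. -/
def octGraph : SimpleGraph (Fin 6) where
  Adj u v := octThird u v ≠ u
  symm := ⟨by decide⟩
  loopless := ⟨by decide⟩

instance : DecidableRel octGraph.Adj := fun u v => inferInstanceAs (Decidable (octThird u v ≠ u))

lemma octThird_spec : ∀ u v, octGraph.Adj u v → octGraph.Adj v (octThird u v) ∧
    octGraph.Adj (octThird u v) u ∧ octThird v (octThird u v) = u ∧
    octThird (octThird u v) u = v := by
  decide

/-- The faces of the octahedron are the triangles `u v (octThird u v)`. -/
def octFacePerm : Equiv.Perm octGraph.Dart where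
  toFun d := ⟨(d.snd, octThird d.fst d.snd), (octThird_spec _ _ d.adj).1⟩
  invFun d := ⟨(octThird d.fst d.snd, d.fst), (octThird_spec _ _ d.adj).2.1⟩
  left_inv d := Dart.ext _ _ (Prod.ext (octThird_spec _ _ d.adj).2.2.1 rfl)
  right_inv d := Dart.ext _ _ (Prod.ext rfl (octThird_spec _ _ d.adj).2.2.2)

/-- The drawing of the octahedron. -/
def octRot : RotationSystem octGraph := by
  refine RotationSystem.ofFacePerm octFacePerm (fun _ => rfl) ?_
  have h : ∀ u v w, octGraph.Adj u v → octGraph.Adj u w → w = v ∨ w = octThird v u ∨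
      w = octThird (octThird v u) u ∨ w = octThird (octThird (octThird v u) u) u := by
    decide
  rintro ⟨⟨u, v⟩, hv⟩ ⟨⟨u', w⟩, hw⟩ (rfl : u = u')
  rcases h u v w hv hw with rfl | rfl | rfl | rfl
  exacts [⟨0, rfl⟩, ⟨1, rfl⟩, ⟨2, rfl⟩, ⟨3, rfl⟩]

lemma octRot_isFace {u v w : Fin 6} (h : octGraph.Adj u v) (hw : octThird u v = w) :
    octRot.IsFace u v w := by
  subst hw
  obtain ⟨h1, h2, h3, h4⟩ := octThird_spec u v h
  refine ⟨h, h1, h2, rfl, ?_, ?_⟩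
  · exact Dart.ext _ _ (Prod.ext rfl h3)
  · exact Dart.ext _ _ (Prod.ext rfl h4)

lemma octRot_isSpherical : octRot.IsSpherical := by
  refine octRot.isSpherical_of_le ?_
  have hE : octGraph.edgeSet.ncard = 12 := by
    have h1 := card_dart_eq octGraph
    have h2 : Nat.card octGraph.Dart =
        Nat.card {p : Fin 6 × Fin 6 // octGraph.Adj p.1 p.2} :=
      Nat.card_congr ⟨fun d => ⟨d.toProd, d.adj⟩, fun p => ⟨p.1, p.2⟩, fun _ => rfl, fun _ => rfl⟩
    have h3 : Nat.card {p : Fin 6 × Fin 6 // octGraph.Adj p.1 p.2} = 24 := by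
      rw [Nat.card_eq_fintype_card]
      decide
    omega
  have hC : Nat.card octGraph.ConnectedComponent ≤ 1 := by
    rw [Finite.card_le_one_iff_subsingleton]
    have h : ∀ v, octGraph.Reachable 0 v := by
      intro v
      have h1 : ∀ v, v = 0 ∨ octGraph.Adj 0 v ∨ octGraph.Adj 0 1 ∧ octGraph.Adj 1 v := by decide
      rcases h1 v with rfl | h1 | ⟨h1, h2⟩
      · exact .refl _
      · exact h1.reachable
      · exact h1.reachable.trans h2.reachable
    refine ⟨fun C C' => ?_⟩
    induction C using ConnectedComponent.ind with
    | _ v =>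
    induction C' using ConnectedComponent.ind with
    | _ w => exact ConnectedComponent.sound ((h v).symm.trans (h w))
  have hF : 8 ≤ octRot.facePerm.numCycles := by
    -- faces are told apart by their sets of vertices
    let g : octGraph.Dart → Finset (Fin 6) := fun d => {d.fst, d.snd, octThird d.fst d.snd}
    have hg : ∀ d, g (octRot.facePerm d) = g d := by
      have h : ∀ u v, octGraph.Adj u v →
          ({v, octThird u v, octThird v (octThird u v)} : Finset (Fin 6)) =
            {u, v, octThird u v} := by
        decide
      exact fun d => h _ _ d.adj
    let u : Fin 8 → Fin 6 := ![0, 1, 2, 1, 3, 4, 5, 3]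
    let v : Fin 8 → Fin 6 := ![1, 2, 0, 0, 1, 2, 0, 4]
    have h8 : ∀ i, octGraph.Adj (u i) (v i) := by decide
    let f : Fin 8 → octGraph.Dart := fun i => ⟨(u i, v i), h8 i⟩
    have hf : Function.Injective fun i => g (f i) := by
      have : ∀ i j, ({u i, v i, octThird (u i) (v i)} : Finset (Fin 6)) =
          {u j, v j, octThird (u j) (v j)} → i = j := by
        decide
      exact fun i j h => this i j h
    rw [← Nat.card_fin 8]
    refine Nat.card_le_card_of_injective (fun i => Quotient.mk _ (f i)) fun i j h => hf ?_
    exact Equiv.Perm.SameCycle.map_eq g hg (Quotient.exact h)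
  have h1 := octRot.numFaces_eq
  have h2 : Nat.card (Fin 6) = 6 := Nat.card_fin 6
  omega

/-- The orientation of the octahedron in which an edge `u v` with `u < v` is directed from `u` to
`v` if and only if `s u v` holds. -/
def octPlaneDigraph (s : Fin 6 → Fin 6 → Prop) : PlaneDigraph (Fin 6) where
  graph := octGraph
  rot := octRot
  digraph := ⟨fun u v => octGraph.Adj u v ∧ ((u < v ∧ s u v) ∨ (v < u ∧ ¬ s v u))⟩
  isSpherical := octRot_isSpherical
  isOrientationOf :=
    { adj_iff := fun u v => by
        constructor
        · intro h
          rcases lt_or_gt_of_ne h.ne with huv | huv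
          · by_cases hs : s u v
            · exact .inl ⟨h, .inl ⟨huv, hs⟩⟩
            · exact .inr ⟨h.symm, .inr ⟨huv, hs⟩⟩
          · by_cases hs : s v u
            · exact .inr ⟨h.symm, .inl ⟨huv, hs⟩⟩
            · exact .inl ⟨h, .inr ⟨huv, hs⟩⟩
        · rintro (h | h)
          exacts [h.1, h.1.symm]
      asymm := by
        rintro u v ⟨-, ⟨h1, h2⟩ | ⟨h1, h2⟩⟩ ⟨-, ⟨h3, h4⟩ | ⟨h3, h4⟩⟩
        · exact lt_asymm h1 h3
        · exact h4 h2
        · exact h2 h4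
        · exact lt_asymm h1 h3 }

lemma octPlaneDigraph_adj_of_lt (s : Fin 6 → Fin 6 → Prop) {u v : Fin 6} (h : octGraph.Adj u v)
    (huv : u < v) : (octPlaneDigraph s).digraph.Adj u v ↔ s u v := by
  change octGraph.Adj u v ∧ ((u < v ∧ s u v) ∨ (v < u ∧ ¬ s v u)) ↔ s u v
  simp [h, huv, huv.not_gt]

lemma octPlaneDigraph_adj_of_gt (s : Fin 6 → Fin 6 → Prop) {u v : Fin 6} (h : octGraph.Adj u v)
    (huv : v < u) : (octPlaneDigraph s).digraph.Adj u v ↔ ¬ s v u := by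
  change octGraph.Adj u v ∧ ((u < v ∧ s u v) ∨ (v < u ∧ ¬ s v u)) ↔ ¬ s v u
  simp [h, huv, huv.not_gt]

/-! ### Acyclic colourings -/

namespace Digraph

variable {V W : Type u} {k : ℕ}

lemma IsAcyclicColouring.comp {D : Digraph V} {D' : Digraph W} {f : V → W}
    (hf : ∀ x y, D.Adj x y → D'.Adj (f x) (f y)) {c : W → Fin k} (hc : D'.IsAcyclicColouring c) :
    D.IsAcyclicColouring (c ∘ f) := fun i x hx =>
  hc i (f x) (hx.lift f fun a b hab => ⟨hab.1, hab.2.1, hf a b hab.2.2⟩)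

lemma IsAcyclicColouring.perm {D : Digraph V} {c : V → Fin k} (hc : D.IsAcyclicColouring c)
    (e : Equiv.Perm (Fin k)) : D.IsAcyclicColouring (e ∘ c) := by
  intro i
  have : e ∘ c ⁻¹' {i} = c ⁻¹' {e.symm i} := by
    ext v
    simp [Equiv.eq_symm_apply]
  rw [this]
  exact hc _

lemma IsAcyclicColouring.not_mono {D : Digraph V} {c : V → Fin k} (hc : D.IsAcyclicColouring c)
    {x y z : V} (hxy : D.Adj x y) (hyz : D.Adj y z) (hzx : D.Adj z x) :
    ¬ (c x = c y ∧ c y = c z) := by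
  rintro ⟨h1, h2⟩
  have hx : x ∈ c ⁻¹' {c z} := h1.trans h2
  have hy : y ∈ c ⁻¹' {c z} := h2
  have hz : z ∈ c ⁻¹' {c z} := rfl
  exact hc (c z) x (((Relation.TransGen.single ⟨hx, hy, hxy⟩).tail ⟨hy, hz, hyz⟩).tail ⟨hz, hx, hzx⟩)

lemma IsAcyclicOn.mono {D D' : Digraph V} {X Y : Set V} (h : D'.IsAcyclicOn Y)
    (hXY : ∀ u ∈ X, ∀ v ∈ X, D.Adj u v → u ∈ Y ∧ v ∈ Y ∧ D'.Adj u v) : D.IsAcyclicOn X :=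
  fun x hx => h x (hx.lift id fun u v huv => hXY u huv.1 v huv.2.1 huv.2.2)

/-- If two induced subdigraphs cover a digraph and overlap in a tournament, then a set of vertices
is acyclic as soon as its parts on the two sides are: a detour into one side leaves the
overlap and comes back to it, and can be replaced by an arc of the tournament. -/
lemma IsAcyclicOn.of_cover {D : Digraph V} {X s t : Set V}
    (harc : ∀ u v, D.Adj u v → (u ∈ s ∧ v ∈ s) ∨ (u ∈ t ∧ v ∈ t))
    (hst : ∀ u ∈ s, u ∈ t → ∀ v ∈ s, v ∈ t → u ≠ v → D.Adj u v ∨ D.Adj v u)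
    (hs : D.IsAcyclicOn (X ∩ s)) (ht : D.IsAcyclicOn (X ∩ t)) : D.IsAcyclicOn X := by
  have key : ∀ s t : Set V, (∀ u v, D.Adj u v → (u ∈ s ∧ v ∈ s) ∨ (u ∈ t ∧ v ∈ t)) →
      (∀ u ∈ s, u ∈ t → ∀ v ∈ s, v ∈ t → u ≠ v → D.Adj u v ∨ D.Adj v u) →
      D.IsAcyclicOn (X ∩ s) → D.IsAcyclicOn (X ∩ t) → ∀ x ∈ s,
      ¬ Relation.TransGen (fun y z => y ∈ X ∧ z ∈ X ∧ D.Adj y z) x x := by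
    intro s t harc hst hs ht x hx hcyc
    let r₁ : V → V → Prop := fun y z => y ∈ X ∩ s ∧ z ∈ X ∩ s ∧ D.Adj y z
    let r₂ : V → V → Prop := fun y z => y ∈ X ∩ t ∧ z ∈ X ∩ t ∧ D.Adj y z
    have hX : ∀ {u v}, Relation.TransGen r₂ u v → u ∈ X ∧ v ∈ X := fun h =>
      ⟨(Relation.TransGen.head'_iff.1 h).choose_spec.1.1.1,
        (Relation.TransGen.tail'_iff.1 h).choose_spec.2.2.1.1⟩
    have hshort : ∀ u v, u ∈ s → u ∈ t → v ∈ s → v ∈ t → Relation.TransGen r₂ u v → r₁ u v := by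
      intro u v hus hut hvs hvt huv
      have hX' := hX huv
      have hne : u ≠ v := by
        rintro rfl
        exact ht u huv
      refine ⟨⟨hX'.1, hus⟩, ⟨hX'.2, hvs⟩, (hst u hus hut v hvs hvt hne).resolve_right fun h => ?_⟩
      exact ht u (huv.tail ⟨⟨hX'.2, hvt⟩, ⟨hX'.1, hut⟩, h⟩)
    have main : ∀ q, Relation.TransGen (fun y z => y ∈ X ∧ z ∈ X ∧ D.Adj y z) x q →
        (q ∈ s ∧ Relation.TransGen r₁ x q) ∨ (q ∉ s ∧ ∃ u, u ∈ s ∧ u ∈ t ∧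
          Relation.ReflTransGen r₁ x u ∧ Relation.TransGen r₂ u q) := by
      have hstep : ∀ q q', q ∈ s → Relation.ReflTransGen r₁ x q → q ∈ X → q' ∈ X → D.Adj q q' →
          (q' ∈ s ∧ Relation.TransGen r₁ x q') ∨ (q' ∉ s ∧ ∃ u, u ∈ s ∧ u ∈ t ∧
            Relation.ReflTransGen r₁ x u ∧ Relation.TransGen r₂ u q') := by
        intro q q' hq hxq hqX hq'X h
        by_cases hq' : q' ∈ s
        · exact .inl ⟨hq', Relation.TransGen.tail' hxq ⟨⟨hqX, hq⟩, ⟨hq'X, hq'⟩, h⟩⟩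
        · obtain ⟨h1, h2⟩ := (harc q q' h).resolve_left fun h' => hq' h'.2
          exact .inr ⟨hq', q, hq, h1, hxq, .single ⟨⟨hqX, h1⟩, ⟨hq'X, h2⟩, h⟩⟩
      intro q hq
      induction hq with
      | single h => exact hstep _ _ hx .refl h.1 h.2.1 h.2.2
      | @tail q q' _ h ih =>
        rcases ih with ⟨hqs, hxq⟩ | ⟨hqs, u, hus, hut, hxu, huq⟩
        · exact hstep _ _ hqs hxq.to_reflTransGen h.1 h.2.1 h.2.2
        · obtain ⟨h1, h2⟩ := (harc q q' h.2.2).resolve_left fun h' => hqs h'.1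
          have huq' := huq.tail (show r₂ q q' from ⟨⟨h.1, h1⟩, ⟨h.2.1, h2⟩, h.2.2⟩)
          by_cases hq' : q' ∈ s
          · exact .inl ⟨hq', Relation.TransGen.tail' hxu (hshort _ _ hus hut hq' h2 huq')⟩
          · exact .inr ⟨hq', u, hus, hut, hxu, huq'⟩
    rcases main x hcyc with h | h
    · exact hs x h.2
    · exact h.1 hx
  intro x hx
  obtain ⟨y, hxy, -⟩ := Relation.TransGen.head'_iff.1 hx
  rcases harc x y hxy.2.2 with h | h
  · exact key s t harc hst hs ht x h.1 hx
  · exact key t s (fun u v huv => (harc u v huv).symm)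
      (fun u hu hu' v hv hv' => hst u hu' hu v hv' hv) ht hs x h.1 hx

end Digraph

theorem NeumannLaraConjecture.exists_isAcyclicColouring (hNL : NeumannLaraConjecture) {V : Type}
    [Finite V] {G : SimpleGraph V} (hG : G.IsPlanar) {D : Digraph V} (hD : D.IsOrientationOf G) :
    ∃ c : V → Fin 2, D.IsAcyclicColouring c := by
  have h1 : D.dichromaticNumber ≤ 2 :=
    (le_iSup₂ (f := fun (D : Digraph V) (_ : D ∈ {D : Digraph V | D.IsOrientationOf G}) =>
      D.dichromaticNumber) D hD).trans (hNL V G hG)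
  have h2 : D.dichromaticNumber < 3 := h1.trans_lt (by norm_num)
  simp only [Digraph.dichromaticNumber, iInf_lt_iff] at h2
  obtain ⟨k, ⟨-, c, hc⟩, hk⟩ := h2
  have hk2 : k ≤ 2 := by
    have : k < 3 := by exact_mod_cast hk
    omega
  refine ⟨fun v => Fin.castLE hk2 (c v), fun i x hx => ?_⟩
  obtain ⟨y, hxy, -⟩ := Relation.TransGen.head'_iff.1 hx
  refine hc (c x) x (hx.lift id fun u v huv => ?_)
  have hcol : ∀ u, Fin.castLE hk2 (c u) = i → c u = c x := fun u hu =>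
    Fin.castLE_injective hk2 (hu.trans (show Fin.castLE hk2 (c x) = i from hxy.1).symm)
  exact ⟨hcol u huv.1, hcol v huv.2.1, huv.2.2⟩

/-! ### Triangles that are not monochromatic -/

namespace SimpleGraph.RotationSystem.IsFace

variable {V : Type u} {G : SimpleGraph V} {R : RotationSystem G} {a b c x y z : V}

lemma rotate (h : R.IsFace a b c) : R.IsFace b c a := by
  obtain ⟨h1, h2, h3, e1, e2, e3⟩ := h
  exact ⟨h2, h3, h1, e2, e3, e1⟩

lemma third_unique (h : R.IsFace a b c) (h' : R.IsFace a b z) : z = c := by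
  obtain ⟨h1, h2, h3, e1, -⟩ := h
  obtain ⟨h1', h2', h3', e1', -⟩ := h'
  have := congrArg (fun d : G.Dart => d.snd) (e1'.symm.trans e1)
  exact this

/-- A face with a side of the face `a b c` is a rotation of it. -/
lemma eq_of_side (h : R.IsFace a b c) (h' : R.IsFace x y z)
    (hs : (x = a ∧ y = b) ∨ (x = b ∧ y = c) ∨ (x = c ∧ y = a)) :
    (x = a ∧ y = b ∧ z = c) ∨ (x = b ∧ y = c ∧ z = a) ∨ (x = c ∧ y = a ∧ z = b) := by
  rcases hs with ⟨rfl, rfl⟩ | ⟨rfl, rfl⟩ | ⟨rfl, rfl⟩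
  · exact .inl ⟨rfl, rfl, h.third_unique h'⟩
  · exact .inr (.inl ⟨rfl, rfl, h.rotate.third_unique h'⟩)
  · exact .inr (.inr ⟨rfl, rfl, h.rotate.rotate.third_unique h'⟩)

end SimpleGraph.RotationSystem.IsFace

/-- Directions of the edges of the octahedron such that `0 1 2` is not monochromatic in any acyclic
`2`-colouring; the directions `p`, `q`, `r` of the edges `0 1`, `1 2`, `0 2` are arbitrary.  Each of
the vertices `3`, `4`, `5` forms a directed triangle with an edge of `0 1 2`, and the triangle
`3 4 5` is directed as well. -/
def blocker (p q r : Prop) : Fin 6 → Fin 6 → Prop :=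
  ![![False, p, r, ¬ p, False, ¬ r], ![False, False, q, p, ¬ q, False],
    ![False, False, False, False, q, r], ![False, False, False, False, True, False],
    ![False, False, False, False, False, True], fun _ => False]

lemma not_mono_of_blocker (p q r : Prop) {c : Fin 6 → Fin 2}
    (hc : (octPlaneDigraph (blocker p q r)).digraph.IsAcyclicColouring c) :
    ¬ (c 0 = c 1 ∧ c 1 = c 2) := by
  rintro ⟨h1, h2⟩
  have lt : ∀ u v, octGraph.Adj u v → u < v → blocker p q r u v →
      (octPlaneDigraph (blocker p q r)).digraph.Adj u v := fun u v h huv hs =>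
    (octPlaneDigraph_adj_of_lt _ h huv).2 hs
  have gt : ∀ u v, octGraph.Adj u v → v < u → ¬ blocker p q r v u →
      (octPlaneDigraph (blocker p q r)).digraph.Adj u v := fun u v h huv hs =>
    (octPlaneDigraph_adj_of_gt _ h huv).2 hs
  have h3 : c 3 ≠ c 0 := by
    intro h
    by_cases hp : p
    · exact hc.not_mono (lt 0 1 (by decide) (by decide) hp) (lt 1 3 (by decide) (by decide) hp)
        (gt 3 0 (by decide) (by decide) (not_not.2 hp)) ⟨h1, (h.trans h1).symm⟩
    · exact hc.not_mono (gt 1 0 (by decide) (by decide) hp) (lt 0 3 (by decide) (by decide) hp)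
        (gt 3 1 (by decide) (by decide) hp) ⟨h1.symm, h.symm⟩
  have h4 : c 4 ≠ c 0 := by
    intro h
    by_cases hq : q
    · exact hc.not_mono (lt 1 2 (by decide) (by decide) hq) (lt 2 4 (by decide) (by decide) hq)
        (gt 4 1 (by decide) (by decide) (not_not.2 hq)) ⟨h2, (h.trans (h1.trans h2)).symm⟩
    · exact hc.not_mono (gt 2 1 (by decide) (by decide) hq) (lt 1 4 (by decide) (by decide) hq)
        (gt 4 2 (by decide) (by decide) hq) ⟨h2.symm, (h.trans h1).symm⟩
  have h5 : c 5 ≠ c 0 := by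
    intro h
    by_cases hr : r
    · exact hc.not_mono (lt 0 2 (by decide) (by decide) hr) (lt 2 5 (by decide) (by decide) hr)
        (gt 5 0 (by decide) (by decide) (not_not.2 hr)) ⟨h1.trans h2, (h.trans (h1.trans h2)).symm⟩
    · exact hc.not_mono (gt 2 0 (by decide) (by decide) hr) (lt 0 5 (by decide) (by decide) hr)
        (gt 5 2 (by decide) (by decide) hr) ⟨(h1.trans h2).symm, h.symm⟩
  have h345 := hc.not_mono (lt 3 4 (by decide) (by decide) trivial)
    (lt 4 5 (by decide) (by decide) trivial) (gt 5 3 (by decide) (by decide) not_false)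
  exact h345 ⟨by omega, by omega⟩

namespace PlaneDigraph

lemma exists_isAcyclicColouring (hNL : NeumannLaraConjecture) {V : Type} [Finite V]
    (P : PlaneDigraph V) : ∃ c : V → Fin 2, P.digraph.IsAcyclicColouring c :=
  hNL.exists_isAcyclicColouring ⟨P.rot, P.isSpherical⟩ P.isOrientationOf

lemma adj_iff_not {V : Type u} (P : PlaneDigraph V) {x y : V} (h : P.graph.Adj x y) :
    P.digraph.Adj x y ↔ ¬ P.digraph.Adj y x :=
  P.isOrientationOf.adj_iff_not h

lemma adj_map_iff {V W : Type u} {P : PlaneDigraph V} {Q : PlaneDigraph W} {f : V → W}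
    (hf : ∀ x y, P.digraph.Adj x y → Q.digraph.Adj (f x) (f y)) {x y : V} (h : P.graph.Adj x y) :
    Q.digraph.Adj (f x) (f y) ↔ P.digraph.Adj x y := by
  refine ⟨fun h' => (P.adj_iff_not h).2 fun h'' => ?_, hf x y⟩
  exact Q.isOrientationOf.asymm _ _ h' (hf _ _ h'')

/-- An octahedron can be glued into a facial triangle such that this triangle is not monochromatic
in any acyclic `2`-colouring of the larger graph. -/
lemma exists_blocked {V : Type} [Finite V] (P : PlaneDigraph V) {a b d : V}
    (h : P.rot.IsFace a b d) :
    ∃ (W : Type) (_ : Finite W) (Q : PlaneDigraph W) (f : V → W), Function.Injective f ∧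
      (∀ x y, P.digraph.Adj x y → Q.digraph.Adj (f x) (f y)) ∧
      (∀ c : W → Fin 2, Q.digraph.IsAcyclicColouring c →
        ¬ (c (f a) = c (f b) ∧ c (f b) = c (f d))) ∧
      ∀ x y z, P.rot.IsFace x y z → ¬ ((x = a ∧ y = b) ∨ (x = b ∧ y = d) ∨ (x = d ∧ y = a)) →
        Q.rot.IsFace (f x) (f y) (f z) := by
  obtain ⟨hab, hbd, hda, -⟩ := id h
  let O := octPlaneDigraph (blocker (P.digraph.Adj a b) (P.digraph.Adj b d) (P.digraph.Adj a d))
  have h01 : O.digraph.Adj 0 1 ↔ P.digraph.Adj a b :=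
    octPlaneDigraph_adj_of_lt _ (by decide) (by decide)
  have h12 : O.digraph.Adj 1 2 ↔ P.digraph.Adj b d :=
    octPlaneDigraph_adj_of_lt _ (by decide) (by decide)
  have h20 : O.digraph.Adj 2 0 ↔ P.digraph.Adj d a :=
    (octPlaneDigraph_adj_of_gt _ (by decide) (by decide)).trans (P.adj_iff_not hda).symm
  obtain ⟨W, hW, Q, f₁, f₂, hf₁, hQ₁, hQ₂, ha, hb, hd, hface⟩ := P.exists_glue O (a' := 0)
    (b' := 1) (c' := 2) h (octRot_isFace (by decide) (by decide)) h01.symm h12.symm h20.symm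
  refine ⟨W, hW, Q, f₁, hf₁, hQ₁, fun c hc => ?_, hface⟩
  rw [ha, hb, hd]
  exact not_mono_of_blocker _ _ _ (hc.comp hQ₂)

/-- Octahedra can be glued into all faces of a set `L` of facial triangles, keeping a facial triangle
`x y z` that does not belong to `L`. -/
lemma exists_saturated {V : Type} [Finite V] (P : PlaneDigraph V) (L : Set (V × V × V))
    (hL : ∀ t ∈ L, P.rot.IsFace t.1 t.2.1 t.2.2) {x y z : V} (h : P.rot.IsFace x y z)
    (hxyz : ∀ t ∈ L, ¬ ((t.1 = x ∧ t.2.1 = y) ∨ (t.1 = y ∧ t.2.1 = z) ∨ (t.1 = z ∧ t.2.1 = x))) :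
    ∃ (W : Type) (_ : Finite W) (Q : PlaneDigraph W) (f : V → W),
      (∀ u v, P.digraph.Adj u v → Q.digraph.Adj (f u) (f v)) ∧
      Q.rot.IsFace (f x) (f y) (f z) ∧ ∀ c : W → Fin 2, Q.digraph.IsAcyclicColouring c →
        ∀ t ∈ L, ¬ (c (f t.1) = c (f t.2.1) ∧ c (f t.2.1) = c (f t.2.2)) := by
  induction hn : L.ncard using Nat.strong_induction_on generalizing V with
  | _ n ih =>
  rcases L.eq_empty_or_nonempty with rfl | ⟨⟨a, b, d⟩, ht⟩
  · exact ⟨V, inferInstance, P, id, fun _ _ h => h, h, fun _ _ t ht => absurd ht (by simp)⟩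
  · have habd : P.rot.IsFace a b d := hL _ ht
    obtain ⟨W, hW, Q, f, hf, hPQ, hmono, hface⟩ := P.exists_blocked habd
    let M : Set (V × V × V) := {t ∈ L |
      ¬ ((t.1 = a ∧ t.2.1 = b) ∨ (t.1 = b ∧ t.2.1 = d) ∨ (t.1 = d ∧ t.2.1 = a))}
    have hM : M.ncard < n := by
      rw [← hn]
      refine Set.ncard_lt_ncard ⟨fun t ht => ht.1, fun hsub => ?_⟩
      exact (hsub ht).2 (.inl ⟨rfl, rfl⟩)
    let g : V × V × V → W × W × W := fun t => (f t.1, f t.2.1, f t.2.2)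
    have hxy : ¬ ((x = a ∧ y = b) ∨ (x = b ∧ y = d) ∨ (x = d ∧ y = a)) := by
      intro hs
      refine hxyz _ ht ?_
      rcases habd.eq_of_side h hs with ⟨rfl, rfl, rfl⟩ | ⟨rfl, rfl, rfl⟩ | ⟨rfl, rfl, rfl⟩ <;> simp
    obtain ⟨W', hW', Q', f', hQQ', hface', hmono'⟩ := ih (g '' M).ncard
      ((Set.ncard_image_le M.toFinite).trans_lt hM) Q (g '' M)
      (by
        rintro _ ⟨t, ht, rfl⟩
        exact hface _ _ _ (hL t ht.1) ht.2)
      (hface _ _ _ h hxy)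
      (by
        rintro _ ⟨t, ht, rfl⟩
        simp only [g, hf.eq_iff]
        exact hxyz t ht.1) rfl
    refine ⟨W', hW', Q', f' ∘ f, fun u v huv => hQQ' _ _ (hPQ _ _ huv), hface', fun c hc t htL => ?_⟩
    by_cases hs : (t.1 = a ∧ t.2.1 = b) ∨ (t.1 = b ∧ t.2.1 = d) ∨ (t.1 = d ∧ t.2.1 = a)
    · have h1 := hmono _ (hc.comp hQQ')
      rintro ⟨h2, h3⟩
      rcases habd.eq_of_side (hL t htL) hs with ⟨h4, h5, h6⟩ | ⟨h4, h5, h6⟩ | ⟨h4, h5, h6⟩ <;>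
        rw [h4, h5] at h2 <;> rw [h5, h6] at h3 <;> simp only [Function.comp] at h1 h2 h3
      · exact h1 ⟨h2, h3⟩
      · exact h1 ⟨(h2.trans h3).symm, h2⟩
      · exact h1 ⟨h3, (h2.trans h3).symm⟩
    · exact hmono' c hc _ ⟨t, ⟨htL, hs⟩, rfl⟩

/-- The two ends of a side of a facial triangle may get the same colour: three copies of the graph
are glued into an octahedron, such that this side is identified with the three edges of a
triangle in turn.  Two vertices of this triangle have the same colour. -/
lemma exists_isAcyclicColouring_eq (hNL : NeumannLaraConjecture) {V : Type} [Finite V]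
    (P : PlaneDigraph V) {x y z : V} (h : P.rot.IsFace x y z) :
    ∃ c : V → Fin 2, P.digraph.IsAcyclicColouring c ∧ c x = c y := by
  obtain ⟨hxy, hyz, hzx, -⟩ := id h
  set α := P.digraph.Adj y x with hα
  set β := P.digraph.Adj x z with hβ
  set γ := P.digraph.Adj z y with hγ
  -- directions for which the faces `0 1 3`, `1 2 4`, `2 0 5` are directed like the triangle `y x z`
  let O := octPlaneDigraph
    ![![False, α, ¬ α, ¬ γ, False, β], ![False, False, α, β, ¬ γ, False],
      ![False, False, False, False, β, ¬ γ], fun _ => False, fun _ => False, fun _ => False]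
  have h01 : O.digraph.Adj 0 1 ↔ α := octPlaneDigraph_adj_of_lt _ (by decide) (by decide)
  have h13 : O.digraph.Adj 1 3 ↔ β := octPlaneDigraph_adj_of_lt _ (by decide) (by decide)
  have h30 : O.digraph.Adj 3 0 ↔ γ :=
    (octPlaneDigraph_adj_of_gt _ (by decide) (by decide)).trans not_not
  have h12 : O.digraph.Adj 1 2 ↔ α := octPlaneDigraph_adj_of_lt _ (by decide) (by decide)
  have h24 : O.digraph.Adj 2 4 ↔ β := octPlaneDigraph_adj_of_lt _ (by decide) (by decide)
  have h41 : O.digraph.Adj 4 1 ↔ γ :=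
    (octPlaneDigraph_adj_of_gt _ (by decide) (by decide)).trans not_not
  have h20 : O.digraph.Adj 2 0 ↔ α :=
    (octPlaneDigraph_adj_of_gt _ (by decide) (by decide)).trans not_not
  have h05 : O.digraph.Adj 0 5 ↔ β := octPlaneDigraph_adj_of_lt _ (by decide) (by decide)
  have h52 : O.digraph.Adj 5 2 ↔ γ :=
    (octPlaneDigraph_adj_of_gt _ (by decide) (by decide)).trans not_not
  have face : ∀ u v w, octGraph.Adj u v → octThird u v = w → O.rot.IsFace u v w :=
    fun u v w h hw => octRot_isFace h hw
  have adj : ∀ u v, octGraph.Adj u v → O.graph.Adj u v := fun _ _ h => h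
  obtain ⟨W₁, _, P₁, f₁, g₁, hf₁, hO₁, hP₁, e0, e1, -, hface₁⟩ :=
    O.exists_glue P (face 0 1 3 (by decide) (by decide)) h h01 h13 h30
  have k12 := (adj_map_iff hO₁ (adj 1 2 (by decide))).trans h12
  have k24 := (adj_map_iff hO₁ (adj 2 4 (by decide))).trans h24
  have k41 := (adj_map_iff hO₁ (adj 4 1 (by decide))).trans h41
  obtain ⟨W₂, _, P₂, f₂, g₂, hf₂, hO₂, hP₂, e1', e2, -, hface₂⟩ :=
    P₁.exists_glue P (hface₁ _ _ _ (face 1 2 4 (by decide) (by decide)) (by decide)) h k12 k24 k41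
  have hO₂' : ∀ u v, O.digraph.Adj u v → P₂.digraph.Adj (f₂ (f₁ u)) (f₂ (f₁ v)) :=
    fun u v h => hO₂ _ _ (hO₁ _ _ h)
  have k20 := (adj_map_iff (f := f₂ ∘ f₁) hO₂' (adj 2 0 (by decide))).trans h20
  have k05 := (adj_map_iff (f := f₂ ∘ f₁) hO₂' (adj 0 5 (by decide))).trans h05
  have k52 := (adj_map_iff (f := f₂ ∘ f₁) hO₂' (adj 5 2 (by decide))).trans h52
  have hface₃ := hface₂ _ _ _ (hface₁ _ _ _ (face 2 0 5 (by decide) (by decide)) (by decide))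
    (by simp only [hf₁.eq_iff]; decide)
  obtain ⟨W₃, _, P₃, f₃, g₃, hf₃, hO₃, hP₃, e2', e0', -, -⟩ := P₂.exists_glue P hface₃ h k20 k05 k52
  obtain ⟨c, hc⟩ := P₃.exists_isAcyclicColouring hNL
  -- the colours of the three corners `0`, `1`, `2` of the octahedron
  have hpigeon : c (f₃ (f₂ (f₁ 0))) = c (f₃ (f₂ (f₁ 1))) ∨
      c (f₃ (f₂ (f₁ 1))) = c (f₃ (f₂ (f₁ 2))) ∨ c (f₃ (f₂ (f₁ 2))) = c (f₃ (f₂ (f₁ 0))) := by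
    omega
  rcases hpigeon with heq | heq | heq
  · refine ⟨c ∘ f₃ ∘ f₂ ∘ g₁, hc.comp fun u v huv => hO₃ _ _ (hO₂ _ _ (hP₁ _ _ huv)), ?_⟩
    simp only [Function.comp, ← e0, ← e1, heq]
  · refine ⟨c ∘ f₃ ∘ g₂, hc.comp fun u v huv => hO₃ _ _ (hP₂ _ _ huv), ?_⟩
    simp only [Function.comp, ← e1', ← e2, heq]
  · refine ⟨c ∘ g₃, hc.comp hP₃, ?_⟩
    have h1 : f₃ (f₂ (f₁ 2)) = g₃ y := e2'
    have h2 : f₃ (f₂ (f₁ 0)) = g₃ x := e0'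
    simp only [Function.comp, ← h1, ← h2, heq]

/-- There is an acyclic `2`-colouring under which no facial triangle is monochromatic and the ends
of a given side of a facial triangle get the same colour.  The octahedron which blocks the triangle
`x y z` itself has a further face at the side `x y`, so that this side still belongs to a face. -/
lemma exists_isAcyclicColouring_faces (hNL : NeumannLaraConjecture) {V : Type} [Finite V]
    (P : PlaneDigraph V) {x y z : V} (h : P.rot.IsFace x y z) :
    ∃ c : V → Fin 2, P.digraph.IsAcyclicColouring c ∧ c x = c y ∧
      ∀ u v w, P.rot.IsFace u v w → ¬ (c u = c v ∧ c v = c w) := by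
  let L : Set (V × V × V) := {t | P.rot.IsFace t.1 t.2.1 t.2.2 ∧
    ¬ ((t.1 = x ∧ t.2.1 = y) ∨ (t.1 = y ∧ t.2.1 = z) ∨ (t.1 = z ∧ t.2.1 = x))}
  obtain ⟨W, _, Q, f, hPQ, hface, hmono⟩ :=
    P.exists_saturated L (fun t ht => ht.1) h fun t ht => ht.2
  obtain ⟨hxy, hyz, hzx, -⟩ := id hface
  let O := octPlaneDigraph (blocker (Q.digraph.Adj (f x) (f y)) (Q.digraph.Adj (f y) (f z))
    (Q.digraph.Adj (f x) (f z)))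
  have h10 : O.digraph.Adj 1 0 ↔ Q.digraph.Adj (f y) (f x) :=
    (octPlaneDigraph_adj_of_gt _ (by decide) (by decide)).trans (Q.adj_iff_not hxy.symm).symm
  have h02 : O.digraph.Adj 0 2 ↔ Q.digraph.Adj (f x) (f z) :=
    octPlaneDigraph_adj_of_lt _ (by decide) (by decide)
  have h21 : O.digraph.Adj 2 1 ↔ Q.digraph.Adj (f z) (f y) :=
    (octPlaneDigraph_adj_of_gt _ (by decide) (by decide)).trans (Q.adj_iff_not hyz.symm).symm
  obtain ⟨W', _, Q', f', g', -, hO', hQ', ey, ex, ez, hface'⟩ :=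
    O.exists_glue Q (a := 1) (b := 0) (c := 2) (octRot_isFace (by decide) (by decide)) hface
      h10 h02 h21
  -- the face of the octahedron on the other side of the edge `0 1`
  obtain ⟨c, hc, hc01⟩ := Q'.exists_isAcyclicColouring_eq hNL
    (hface' 0 1 3 (octRot_isFace (by decide) (by decide)) (by decide))
  have hblock := not_mono_of_blocker _ _ _ (hc.comp hO')
  simp only [Function.comp, ex, ey, ez] at hblock hc01
  refine ⟨c ∘ g' ∘ f, hc.comp fun u v huv => hQ' _ _ (hPQ _ _ huv), hc01, fun u v w huvw => ?_⟩
  by_cases hs : (u = x ∧ v = y) ∨ (u = y ∧ v = z) ∨ (u = z ∧ v = x)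
  · rintro ⟨h2, h3⟩
    simp only [Function.comp] at h2 h3
    rcases h.eq_of_side huvw hs with ⟨rfl, rfl, rfl⟩ | ⟨rfl, rfl, rfl⟩ | ⟨rfl, rfl, rfl⟩
    · exact hblock ⟨h2, h3⟩
    · exact hblock ⟨(h2.trans h3).symm, h2⟩
    · exact hblock ⟨h3, (h2.trans h3).symm⟩
  · exact hmono _ (hc.comp hQ') (u, v, w) ⟨huvw, hs⟩

end PlaneDigraph

/-! ### Gluing colourings along a separating triangle -/

namespace SimpleGraph

variable {V : Type u}

/-- The graph with the edges of `G` inside `s`, on the same vertices. -/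
def restrictTo (G : SimpleGraph V) (s : Set V) : SimpleGraph V where
  Adj u v := G.Adj u v ∧ u ∈ s ∧ v ∈ s
  symm := ⟨fun _ _ h => ⟨h.1.symm, h.2.2, h.2.1⟩⟩
  loopless := ⟨fun _ h => G.irrefl h.1⟩

lemma restrictTo_le (G : SimpleGraph V) (s : Set V) : G.restrictTo s ≤ G := fun _ _ h => h.1

lemma ncard_edgeSet_restrictTo_lt [Finite V] {G : SimpleGraph V} {s : Set V} {u v : V}
    (huv : G.Adj u v) (hu : u ∉ s) : (G.restrictTo s).edgeSet.ncard < G.edgeSet.ncard :=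
  Set.ncard_lt_ncard ⟨edgeSet_mono (G.restrictTo_le s), fun h =>
    hu (h (show s(u, v) ∈ G.edgeSet from huv) : (G.restrictTo s).Adj u v).2.1⟩

end SimpleGraph

namespace Digraph

variable {V : Type u} {k : ℕ}

/-- The digraph with the arcs of `D` inside `s`, on the same vertices. -/
def restrictTo (D : Digraph V) (s : Set V) : Digraph V := ⟨fun u v => D.Adj u v ∧ u ∈ s ∧ v ∈ s⟩

lemma IsOrientationOf.restrictTo {D : Digraph V} {G : SimpleGraph V} (h : D.IsOrientationOf G)
    (s : Set V) : (D.restrictTo s).IsOrientationOf (G.restrictTo s) where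
  adj_iff u v := by
    have := h.adj_iff u v
    change G.Adj u v ∧ u ∈ s ∧ v ∈ s ↔ (D.Adj u v ∧ u ∈ s ∧ v ∈ s) ∨ (D.Adj v u ∧ v ∈ s ∧ u ∈ s)
    tauto
  asymm u v huv hvu := h.asymm u v huv.1 hvu.1

/-- An acyclic colouring of `D` without monochromatic triangles of the underlying graph `G`. -/
def IsGoodColouring (D : Digraph V) (G : SimpleGraph V) (c : V → Fin k) : Prop :=
  D.IsAcyclicColouring c ∧ G.NoMonochromaticTriangle c

lemma IsGoodColouring.perm {D : Digraph V} {G : SimpleGraph V} {c : V → Fin k}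
    (h : D.IsGoodColouring G c) (e : Equiv.Perm (Fin k)) : D.IsGoodColouring G (e ∘ c) :=
  ⟨h.1.perm e, fun x y z hxy hyz hxz hc => h.2 x y z hxy hyz hxz
    ⟨e.injective hc.1, e.injective hc.2⟩⟩

/-- Colourings of two induced subgraphs which cover the graph, overlap in a clique, and agree on this
clique, fit together. -/
lemma IsGoodColouring.exists_of_cover {D : Digraph V} {G : SimpleGraph V}
    (hD : D.IsOrientationOf G) {s t : Set V}
    (hcov : ∀ u v, G.Adj u v → (u ∈ s ∧ v ∈ s) ∨ (u ∈ t ∧ v ∈ t))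
    (hst : ∀ u ∈ s, u ∈ t → ∀ v ∈ s, v ∈ t → u ≠ v → G.Adj u v) {c₁ c₂ : V → Fin k}
    (h₁ : (D.restrictTo s).IsGoodColouring (G.restrictTo s) c₁)
    (h₂ : (D.restrictTo t).IsGoodColouring (G.restrictTo t) c₂)
    (heq : ∀ v ∈ s, v ∈ t → c₁ v = c₂ v) :
    ∃ c, D.IsGoodColouring G c ∧ ∀ v ∈ s, c v = c₁ v := by
  classical
  let c : V → Fin k := fun v => if v ∈ s then c₁ v else c₂ v
  have hc₁ : ∀ v ∈ s, c v = c₁ v := fun v hv => if_pos hv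
  have hc₂ : ∀ v ∈ t, c v = c₂ v := fun v hv => by
    by_cases hs : v ∈ s
    · rw [hc₁ v hs, heq v hs hv]
    · exact if_neg hs
  refine ⟨c, ⟨fun i => ?_, fun x y z hxy hyz hxz => ?_⟩, hc₁⟩
  · refine IsAcyclicOn.of_cover (s := s) (t := t) (fun u v huv => ?_)
      (fun u hu hu' v hv hv' huv => ?_) ?_ ?_
    · exact hcov u v ((hD.adj_iff u v).2 (.inl huv))
    · exact (hD.adj_iff u v).1 (hst u hu hu' v hv hv' huv)
    · refine (h₁.1 i).mono fun u hu v hv huv => ⟨?_, ?_, huv, hu.2, hv.2⟩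
      · exact (hc₁ u hu.2).symm.trans hu.1
      · exact (hc₁ v hv.2).symm.trans hv.1
    · refine (h₂.1 i).mono fun u hu v hv huv => ⟨?_, ?_, huv, hu.2, hv.2⟩
      · exact (hc₂ u hu.2).symm.trans hu.1
      · exact (hc₂ v hv.2).symm.trans hv.1
  · have hcase : (x ∈ s ∧ y ∈ s ∧ z ∈ s) ∨ (x ∈ t ∧ y ∈ t ∧ z ∈ t) := by
      have k1 := hcov x y hxy
      have k2 := hcov y z hyz
      have k3 := hcov x z hxz
      tauto
    rcases hcase with ⟨hx, hy, hz⟩ | ⟨hx, hy, hz⟩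
    · rw [hc₁ x hx, hc₁ y hy, hc₁ z hz]
      exact h₁.2 x y z ⟨hxy, hx, hy⟩ ⟨hyz, hy, hz⟩ ⟨hxz, hx, hz⟩
    · rw [hc₂ x hx, hc₂ y hy, hc₂ z hz]
      exact h₂.2 x y z ⟨hxy, hx, hy⟩ ⟨hyz, hy, hz⟩ ⟨hxz, hx, hz⟩

/-- If the colours of each pair of vertices of each triangle may be equal, then all non-constant
colourings of triangles extend, up to a permutation of the two colours. -/
lemma exists_isGoodColouring_extend {D : Digraph V} {G : SimpleGraph V}
    (h : ∀ x y z, G.Adj x y → G.Adj y z → G.Adj x z →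
      ∃ c : V → Fin 2, D.IsGoodColouring G c ∧ c x = c y) {x y z : V} (hxy : G.Adj x y)
    (hyz : G.Adj y z) (hxz : G.Adj x z) {p q r : Fin 2} (hp : ¬ (p = q ∧ q = r)) :
    ∃ c : V → Fin 2, D.IsGoodColouring G c ∧ c x = p ∧ c y = q ∧ c z = r := by
  have key : ∀ x y z, G.Adj x y → G.Adj y z → G.Adj x z → ∀ p r : Fin 2, p ≠ r →
      ∃ c : V → Fin 2, D.IsGoodColouring G c ∧ c x = p ∧ c y = p ∧ c z = r := by
    intro x y z hxy hyz hxz p r hpr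
    obtain ⟨c, hc, hcxy⟩ := h x y z hxy hyz hxz
    have hcz : c y ≠ c z := fun h => hc.2 x y z hxy hyz hxz ⟨hcxy, h⟩
    by_cases hcp : c x = p
    · exact ⟨c, hc, hcp, hcxy ▸ hcp, by omega⟩
    · have hsw : ∀ i : Fin 2, Equiv.swap 0 1 i ≠ i := by decide
      have h1 := hsw (c x)
      have h2 := hsw (c z)
      refine ⟨Equiv.swap 0 1 ∘ c, hc.perm _, ?_, ?_, ?_⟩ <;> simp only [Function.comp]
      · omega
      · rw [← hcxy]; omega
      · omega
  have h3 : (p = q ∧ p ≠ r) ∨ (q = r ∧ q ≠ p) ∨ (p = r ∧ p ≠ q) := by omega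
  rcases h3 with ⟨rfl, h3⟩ | ⟨rfl, h3⟩ | ⟨rfl, h3⟩
  · exact key x y z hxy hyz hxz _ _ h3
  · obtain ⟨c, hc, h1, h2, h3⟩ := key y z x hyz hxz.symm hxy.symm _ _ h3
    exact ⟨c, hc, h3, h1, h2⟩
  · obtain ⟨c, hc, h1, h2, h3⟩ := key x z y hxz hyz.symm hxy _ _ h3
    exact ⟨c, hc, h1, h3, h2⟩

end Digraph

/-! ### Extending colourings of a triangle -/

/-- Any two vertices of a triangle may get the same colour.  The proof cuts the graph along separating
triangles: the colouring of the side that contains the given triangle is not constant on the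
separating triangle, so that it extends to the other side by induction on the number of edges.
Once no triangle separates, all triangles are facial. -/
lemma NeumannLaraConjecture.exists_isGoodColouring_eq (hNL : NeumannLaraConjecture) {V : Type}
    [Finite V] {G : SimpleGraph V} (hG : G.IsPlanar) {D : Digraph V} (hD : D.IsOrientationOf G)
    {x y z : V} (hxy : G.Adj x y) (hyz : G.Adj y z) (hxz : G.Adj x z) :
    ∃ c : V → Fin 2, D.IsGoodColouring G c ∧ c x = c y := by
  induction hn : G.edgeSet.ncard using Nat.strong_induction_on generalizing G D x y z with
  | _ n ih =>
  obtain ⟨R, hR⟩ := id hG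
  by_cases hall : ∀ a b c, G.Adj a b → G.Adj b c → G.Adj c a → R.IsFace a b c ∨ R.IsFace b a c
  · -- without separating triangles, all triangles are faces
    let P : PlaneDigraph V := ⟨G, R, D, hR, hD⟩
    obtain ⟨c, hc, hcxy, hface⟩ : ∃ c : V → Fin 2, P.digraph.IsAcyclicColouring c ∧ c x = c y ∧
        ∀ u v w, P.rot.IsFace u v w → ¬ (c u = c v ∧ c v = c w) := by
      rcases hall x y z hxy hyz hxz.symm with h | h
      · exact P.exists_isAcyclicColouring_faces hNL h
      · obtain ⟨c, hc, h1, h2⟩ := P.exists_isAcyclicColouring_faces hNL h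
        exact ⟨c, hc, h1.symm, h2⟩
    refine ⟨c, ⟨hc, fun u v w huv hvw huw => ?_⟩, hcxy⟩
    rcases hall u v w huv hvw huw.symm with h | h
    · exact hface u v w h
    · exact fun ⟨h1, h2⟩ => hface v u w h ⟨h1.symm, h1.trans h2⟩
  · push Not at hall
    obtain ⟨a, b, d, hab, hbd, hda, hf1, hf2⟩ := hall
    obtain ⟨A, hAS, hA, ⟨u, hu, u', huu'⟩, w, hw, w', hww'⟩ :=
      ((hR.isFace_or_separates hab hbd hda).resolve_left hf1).resolve_left hf2
    -- the two sides of the separating triangle `a b d`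
    have main : ∀ s t : Set V, (∀ u v, G.Adj u v → (u ∈ s ∧ v ∈ s) ∨ (u ∈ t ∧ v ∈ t)) →
        (∀ v, v ∈ s ∧ v ∈ t ↔ v = a ∨ v = b ∨ v = d) →
        (G.restrictTo s).edgeSet.ncard < G.edgeSet.ncard →
        (G.restrictTo t).edgeSet.ncard < G.edgeSet.ncard → x ∈ s → y ∈ s → z ∈ s →
        ∃ c : V → Fin 2, D.IsGoodColouring G c ∧ c x = c y := by
      intro s t hcov hst hs ht hx hy hz
      have ha := (hst a).2 (by simp)
      have hb := (hst b).2 (by simp)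
      have hd := (hst d).2 (by simp)
      obtain ⟨c₁, hc₁, hc₁xy⟩ := ih _ (hn ▸ hs) (hG.mono (G.restrictTo_le s)) (hD.restrictTo s)
        ⟨hxy, hx, hy⟩ ⟨hyz, hy, hz⟩ ⟨hxz, hx, hz⟩ rfl
      obtain ⟨c₂, hc₂, hc₂a, hc₂b, hc₂d⟩ := Digraph.exists_isGoodColouring_extend
        (D := D.restrictTo t) (G := G.restrictTo t) (fun x y z h1 h2 h3 =>
          ih _ (hn ▸ ht) (hG.mono (G.restrictTo_le t)) (hD.restrictTo t) h1 h2 h3 rfl)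
        ⟨hab, ha.2, hb.2⟩ ⟨hbd, hb.2, hd.2⟩ ⟨hda.symm, ha.2, hd.2⟩
        (hc₁.2 a b d ⟨hab, ha.1, hb.1⟩ ⟨hbd, hb.1, hd.1⟩ ⟨hda.symm, ha.1, hd.1⟩)
      obtain ⟨c, hc, hcs⟩ := Digraph.IsGoodColouring.exists_of_cover hD hcov
        (fun u hu hu' v hv hv' huv => by
          rcases (hst u).1 ⟨hu, hu'⟩ with rfl | rfl | rfl <;>
            rcases (hst v).1 ⟨hv, hv'⟩ with rfl | rfl | rfl <;>
            first | exact absurd rfl huv | assumption | (apply G.adj_symm; assumption))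
        hc₁ hc₂ (fun v hv hv' => by
          rcases (hst v).1 ⟨hv, hv'⟩ with rfl | rfl | rfl
          exacts [hc₂a.symm, hc₂b.symm, hc₂d.symm])
      exact ⟨c, hc, by rw [hcs x hx, hcs y hy, hc₁xy]⟩
    have hcov : ∀ u v, G.Adj u v →
        (u ∈ A ∪ {a, b, d} ∧ v ∈ A ∪ {a, b, d}) ∨ (u ∈ Aᶜ ∧ v ∈ Aᶜ) := by
      intro u v huv
      by_cases hu : u ∈ A
      · exact .inl ⟨.inl hu, hA u hu v huv⟩
      · by_cases hv : v ∈ A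
        · exact .inl ⟨hA v hv u huv.symm, .inl hv⟩
        · exact .inr ⟨hu, hv⟩
    have hst : ∀ v, v ∈ A ∪ {a, b, d} ∧ v ∈ Aᶜ ↔ v = a ∨ v = b ∨ v = d := by
      intro v
      have := hAS v
      simp only [Set.mem_union, Set.mem_insert_iff, Set.mem_singleton_iff, Set.mem_compl_iff] at this ⊢
      tauto
    have hs : (G.restrictTo (A ∪ {a, b, d})).edgeSet.ncard < G.edgeSet.ncard :=
      ncard_edgeSet_restrictTo_lt hww' hw
    have ht : (G.restrictTo Aᶜ).edgeSet.ncard < G.edgeSet.ncard :=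
      ncard_edgeSet_restrictTo_lt huu' (not_not.2 hu)
    have k1 := hcov x y hxy
    have k2 := hcov y z hyz
    have k3 := hcov x z hxz
    have hside : (x ∈ A ∪ {a, b, d} ∧ y ∈ A ∪ {a, b, d} ∧ z ∈ A ∪ {a, b, d}) ∨
        (x ∈ Aᶜ ∧ y ∈ Aᶜ ∧ z ∈ Aᶜ) := by
      tauto
    rcases hside with ⟨hx, hy, hz⟩ | ⟨hx, hy, hz⟩
    · exact main _ _ hcov hst hs ht hx hy hz
    · exact main _ _ (fun u v huv => (hcov u v huv).symm) (fun v => and_comm.trans (hst v)) ht hs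
        hx hy hz

/-! ### Isomorphic copies -/

/-- Planarity is invariant under relabelling of the vertices.  The conjecture speaks of graphs in
`Type`, so that a graph in an arbitrary universe has to be replaced by a copy on `Fin n`. -/
lemma SimpleGraph.IsPlanar.comap {V : Type u} {W : Type*} [Finite V] [Finite W]
    {G : SimpleGraph V} (hG : G.IsPlanar) (e : W ≃ V) : (G.comap e).IsPlanar := by
  obtain ⟨R, hR⟩ := hG
  let H := G.comap e
  let E : H.Dart ≃ G.Dart :=
    { toFun := fun d => ⟨(e d.fst, e d.snd), d.adj⟩
      invFun := fun d => ⟨(e.symm d.fst, e.symm d.snd), by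
        simp [H]⟩
      left_inv := fun d => Dart.ext _ _ (by simp)
      right_inv := fun d => Dart.ext _ _ (by simp) }
  have hsame : ∀ (p : Equiv.Perm H.Dart) (q : Equiv.Perm G.Dart), (∀ d, E (p d) = q (E d)) →
      ∀ d d', p.SameCycle d d' ↔ q.SameCycle (E d) (E d') := by
    intro p q hpq d d'
    have hpow : ∀ n : ℕ, E ((p ^ n) d) = (q ^ n) (E d) := by
      intro n
      induction n with
      | zero => rfl
      | succ n ih => rw [pow_succ', pow_succ', Equiv.Perm.mul_apply, Equiv.Perm.mul_apply, hpq, ih]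
    constructor
    · intro h
      obtain ⟨n, rfl⟩ := h.exists_nat_pow_eq
      rw [hpow, Equiv.Perm.sameCycle_pow_right]
    · intro h
      obtain ⟨n, hn⟩ := h.exists_nat_pow_eq
      rw [← hpow] at hn
      rw [← E.injective hn, Equiv.Perm.sameCycle_pow_right]
  have hnext : ∀ d, E ((E.symm.permCongr R.next) d) = R.next (E d) := fun d => by
    simp [Equiv.permCongr_apply]
  let R' : RotationSystem H := ⟨E.symm.permCongr R.next, fun d d' => by
    rw [hsame _ _ hnext, R.sameCycle_iff]
    exact e.injective.eq_iff⟩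
  refine ⟨R', ?_⟩
  have hV : Nat.card W = Nat.card V := Nat.card_congr e
  have hE : H.edgeSet.ncard = G.edgeSet.ncard := by
    have h1 := Nat.card_congr E
    rw [card_dart_eq, card_dart_eq] at h1
    omega
  have hC : Nat.card H.ConnectedComponent = Nat.card G.ConnectedComponent :=
    Nat.card_congr (Iso.comap e G).connectedComponentEquiv
  have hF : R'.facePerm.numCycles = R.facePerm.numCycles :=
    Nat.card_congr (Quotient.congr E (hsame _ _ fun d => hnext d.symm))
  have hI : {v | H.IsIsolated v}.ncard = {v | G.IsIsolated v}.ncard := by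
    have : {v | H.IsIsolated v} = e ⁻¹' {v | G.IsIsolated v} := by
      ext v
      refine ⟨fun h w hw => h (e.symm w) ?_, fun h w hw => h (e w) hw⟩
      simpa [H] using hw
    rw [this, Set.ncard_preimage_of_injective_subset_range e.injective]
    simp [e.surjective.range_eq]
  have hR' : Nat.card V + R.numFaces = G.edgeSet.ncard + 2 * Nat.card G.ConnectedComponent := hR
  change Nat.card W + R'.numFaces = H.edgeSet.ncard + 2 * Nat.card H.ConnectedComponent
  rw [R.numFaces_eq] at hR'
  rw [R'.numFaces_eq]
  omega

lemma NeumannLaraConjecture.exists_isGoodColouring_triangle (hNL : NeumannLaraConjecture)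
    {V : Type u} [Finite V] {G : SimpleGraph V} (hG : G.IsPlanar) {D : Digraph V}
    (hD : D.IsOrientationOf G) {x y z : V} (hxy : G.Adj x y) (hyz : G.Adj y z) (hxz : G.Adj x z)
    {p q r : Fin 2} (hp : ¬ (p = q ∧ q = r)) :
    ∃ c : V → Fin 2, D.IsGoodColouring G c ∧ c x = p ∧ c y = q ∧ c z = r := by
  refine Digraph.exists_isGoodColouring_extend (fun x y z hxy hyz hxz => ?_) hxy hyz hxz hp
  obtain ⟨n, ⟨e⟩⟩ := Finite.exists_equiv_fin V
  let D' : Digraph (Fin n) := ⟨fun i j => D.Adj (e.symm i) (e.symm j)⟩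
  have hadj : ∀ u v, G.Adj u v → (G.comap e.symm).Adj (e u) (e v) := fun u v h => by
    simpa using h
  obtain ⟨c, hc, hcxy⟩ := hNL.exists_isGoodColouring_eq (hG.comap e.symm) (D := D')
    ⟨fun i j => hD.adj_iff _ _, fun i j => hD.asymm _ _⟩ (hadj _ _ hxy) (hadj _ _ hyz)
    (hadj _ _ hxz)
  refine ⟨c ∘ e, ⟨fun i v hv => ?_, fun u v w huv hvw huw => ?_⟩, hcxy⟩
  · exact hc.1 i (e v) (hv.lift e fun u v huv => ⟨huv.1, huv.2.1, by simpa [D'] using huv.2.2⟩)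
  · exact hc.2 _ _ _ (hadj _ _ huv) (hadj _ _ hvw) (hadj _ _ huw)

/-- Colourings of an edge extend: the edge becomes a side of a triangle after a new vertex is added,
whose colour can be chosen such that the colouring of this triangle is not constant. -/
lemma NeumannLaraConjecture.exists_isGoodColouring_edge (hNL : NeumannLaraConjecture)
    {V : Type u} [Finite V] {G : SimpleGraph V} (hG : G.IsPlanar) {D : Digraph V}
    (hD : D.IsOrientationOf G) {x y : V} (hxy : G.Adj x y) (p q : Fin 2) :
    ∃ c : V → Fin 2, D.IsGoodColouring G c ∧ c x = p ∧ c y = q := by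
  let D' : Digraph (Option V) := ⟨fun
    | some u, some v => D.Adj u v
    | some _, none => False
    | none, some v => v = x ∨ v = y
    | none, none => False⟩
  have hD' : D'.IsOrientationOf (G.addVertex x y) := by
    constructor
    · rintro (_ | u) (_ | v)
      · simp [addVertex, D']
      · simp [addVertex, D']
      · simp [addVertex, D']
      · exact hD.adj_iff u v
    · rintro (_ | u) (_ | v) h
      · exact h.elim
      · exact id
      · exact h.elim
      · exact hD.asymm u v h
  have hr : ∃ r : Fin 2, ¬ (p = q ∧ q = r) :=
    ⟨p + 1, by revert p q; decide⟩
  obtain ⟨r, hr⟩ := hr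
  obtain ⟨c, hc, h1, h2, -⟩ := hNL.exists_isGoodColouring_triangle (hG.addVertex hxy) hD'
    (x := some x) (y := some y) (z := none) hxy (Or.inr rfl) (Or.inl rfl) hr
  refine ⟨c ∘ some, ⟨hc.1.comp (f := some) fun u v h => h, fun u v w huv hvw huw => ?_⟩, h1, h2⟩
  exact hc.2 (some u) (some v) (some w) huv hvw huw

theorem corollary2p3 (hNL : NeumannLaraConjecture)
    {V : Type u} [Finite V] (G : SimpleGraph V) (hG : G.IsPlanar)
    (D : Digraph V) (hD : D.IsOrientationOf G) :
    (∃ c : V → Fin 2, D.IsAcyclicColouring c ∧ G.NoMonochromaticTriangle c) ∧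
    (∀ a₁ a₂ : V, G.Adj a₁ a₂ → ∀ p₁ p₂ : Fin 2,
      ∃ c : V → Fin 2, D.IsAcyclicColouring c ∧ G.NoMonochromaticTriangle c ∧
        c a₁ = p₁ ∧ c a₂ = p₂) ∧
    (∀ a₁ a₂ a₃ : V, G.Adj a₁ a₂ → G.Adj a₂ a₃ → G.Adj a₁ a₃ →
      ∀ p₁ p₂ p₃ : Fin 2, ¬ (p₁ = p₂ ∧ p₂ = p₃) →
      ∃ c : V → Fin 2, D.IsAcyclicColouring c ∧ G.NoMonochromaticTriangle c ∧
        c a₁ = p₁ ∧ c a₂ = p₂ ∧ c a₃ = p₃) := by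
  refine ⟨?_, fun a₁ a₂ h p₁ p₂ => ?_, fun a₁ a₂ a₃ h₁ h₂ h₃ p₁ p₂ p₃ hp => ?_⟩
  · by_cases h : ∃ u v, G.Adj u v
    · obtain ⟨u, v, huv⟩ := h
      obtain ⟨c, hc, -⟩ := hNL.exists_isGoodColouring_edge hG hD huv 0 0
      exact ⟨c, hc⟩
    · push Not at h
      refine ⟨fun _ => 0, fun i x hx => ?_, fun x y z hxy => absurd hxy (h x y)⟩
      obtain ⟨y, hxy, -⟩ := Relation.TransGen.head'_iff.1 hx
      exact h x y ((hD.adj_iff x y).2 (.inl hxy.2.2))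
  · obtain ⟨c, hc, hc'⟩ := hNL.exists_isGoodColouring_edge hG hD h p₁ p₂
    exact ⟨c, hc.1, hc.2, hc'⟩
  · obtain ⟨c, hc, hc'⟩ := hNL.exists_isGoodColouring_triangle hG hD h₁ h₂ h₃ hp
    exact ⟨c, hc.1, hc.2, hc'⟩
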